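/- For integers $n, d \ge 1$, a function $f : \{-1,1\}^n \to \{-1,1\}$ is called a polynomial threshold function of degree $d$ if there is a real polynomial $p$ in $n$ variables, of total degree at most $d$ and with no roots in $\{-1,1\}^n$, such that $f(x) = \operatorname{sgn}(p(x))$ for all $x \in \{-1,1\}^n$. Let $T(n,d)$ denote the number of such functions $f$. (1) There is an absolute constant $C > 0$ such that for all integers $n$ and $d$ with $n > 1$ and $1 \le d \le n^{0.9}$, $$ \Big( 1 - \frac{C}{\log n} \Big)_+^d \cdot \frac{n^{d+1}}{d!} < \log_2 T(n,d) < \frac{n^{d+1}}{d!}, $$ where $\log$ is the natural logarithm and $t_+ = \max(t, 0)$. (2) For all integers $n > 1$ and $1 \le d \le n$ one has $\log_2 T(n,d) \le n^{d+1}/d!$, and the inequality is strict unless $n = d = 2$. -/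

import Mathlib

/-- The `{-1, 1}`-valued Boolean function `f` on the cube `{-1, 1}ⁿ` is a polynomial threshold
function of degree (at most) `d`: it is the sign of some real polynomial in `n` variables of total
degree at most `d` that has no roots in the cube. The set `{-1, 1}` is represented by `ℤˣ`. -/
def IsPolynomialThreshold (n d : ℕ) (f : (Fin n → ℤˣ) → ℤˣ) : Prop :=
  ∃ p : MvPolynomial (Fin n) ℝ, p.totalDegree ≤ d ∧
    ∀ x : Fin n → ℤˣ,
      MvPolynomial.eval (fun i => (((x i : ℤˣ) : ℤ) : ℝ)) p ≠ 0 ∧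
      (((f x : ℤˣ) : ℤ) : ℝ) =
        Real.sign (MvPolynomial.eval (fun i => (((x i : ℤˣ) : ℤ) : ℝ)) p)

/-- `T(n, d)`: the number of polynomial threshold functions of degree `d` in `n` variables. (All
`{-1, 1}`-valued functions on the cube form a finite type, so `Nat.card` is a genuine count.) -/
noncomputable def numPTF (n d : ℕ) : ℕ :=
  Nat.card {f : (Fin n → ℤˣ) → ℤˣ // IsPolynomialThreshold n d f}

/-! Lower bound. Each point of the cube is a hyperplane in the space of polynomials of degree at
most `d`, namely the polynomials vanishing there. Threshold functions are the regions of this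
arrangement, and the flats correspond to zero sets. Deletion and restriction show that regions are
at least as numerous as flats (`zeroSets_ncard_le_posSets_ncard`), so it suffices to find many zero
sets.

Every `k`-tuple of points spans a flat, and a flat `Z` contains at most `|Z| ^ k` tuples; hence many
tuples with small spans give many flats. The cube is split as `{0,1}^(m+1) × {0,1}^n₂`. On the first
factor, at least `2 ^ (m * k)` tuples have independent degree-`d` evaluation vectors: `2 ^ m` points
always have evaluation rank at least `∑ i ≤ d, C(m, i)`, because their standard monomials form a
down-set, to which Kruskal–Katona applies. On the second factor the columns are arbitrary. By
Littlewood–Offord, for at least half of the choices no combination with `s` or more non-zero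
coefficients extends to a point of the full cube. The flat then involves only combinations of at
most `s` rows and is small (`card_flat_le`). Taking `k = C(m, d)`, `s` about `n ^ 0.05` and `n₂`
about `80 n / log n` gives the estimate.

Upper bound. A set shattered by sign patterns is no larger than the dimension of the space, which is
at most `N = ∑ i ≤ d, C(n, i)`. Sauer–Shelah gives `T ≤ (e 2 ^ n / N) ^ N`, and dividing by `N`
saves enough in the exponent to absorb the lower-order terms of `N`. Small `n`, and `d ≥ n - 1`,
follow from the trivial bound `2 ^ 2 ^ n` or from numerical evaluation. -/

/-! ### Zero sets and sign patterns of a finite-dimensional space of functions -/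

namespace PTF

open Finset in
/-- The traces on `A` of the zero sets of the members of `Q`. -/
def zeroSets {X : Type*} (Q : Submodule ℝ (X → ℝ)) (A : Finset X) : Set (Finset X) :=
  {Z | ∃ p ∈ Q, Z = {x ∈ A | p x = 0}}

/-- `p` vanishes at a point of `A` only if every member of `Q` does. -/
def IsGeneric {X : Type*} (Q : Submodule ℝ (X → ℝ)) (A : Finset X) (p : X → ℝ) : Prop :=
  ∀ x ∈ A, p x = 0 → ∀ q ∈ Q, q x = 0

open Finset in
/-- The traces on `A` of the positivity sets of the generic members of `Q`. -/
def posSets {X : Type*} (Q : Submodule ℝ (X → ℝ)) (A : Finset X) : Set (Finset X) :=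
  {P | ∃ p ∈ Q, IsGeneric Q A p ∧ P = {x ∈ A | 0 < p x}}

section Arrangement

variable {X : Type*} {Q : Submodule ℝ (X → ℝ)} {A : Finset X} {x : X}

lemma zeroSets_finite (Q : Submodule ℝ (X → ℝ)) (A : Finset X) : (zeroSets Q A).Finite := by
  refine (A.powerset.finite_toSet).subset ?_
  rintro Z ⟨p, -, rfl⟩
  exact Finset.mem_coe.2 (Finset.mem_powerset.2 (Finset.filter_subset _ _))

lemma posSets_finite (Q : Submodule ℝ (X → ℝ)) (A : Finset X) : (posSets Q A).Finite := by
  refine (A.powerset.finite_toSet).subset ?_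
  rintro Z ⟨p, -, -, rfl⟩
  exact Finset.mem_coe.2 (Finset.mem_powerset.2 (Finset.filter_subset _ _))

lemma exists_small_perturbation (A : Finset X) (p g : X → ℝ) :
    ∃ ε : ℝ, 0 < ε ∧ ∀ y ∈ A, p y ≠ 0 → |ε * g y| < |p y| := by
  have h : ∀ᶠ ε : ℝ in nhdsWithin 0 (Set.Ioi 0), ∀ y ∈ A, p y ≠ 0 → |ε * g y| < |p y| := by
    rw [Filter.eventually_all_finset]
    intro y _
    by_cases hy : p y = 0
    · simp [hy]
    have hc : Filter.Tendsto (fun ε : ℝ => |ε * g y|) (nhdsWithin 0 (Set.Ioi 0)) (nhds 0) := by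
      have : Filter.Tendsto (fun ε : ℝ => |ε * g y|) (nhds 0) (nhds |0 * g y|) :=
        Continuous.tendsto (by fun_prop) 0
      simp only [zero_mul, abs_zero] at this
      exact this.mono_left nhdsWithin_le_nhds
    filter_upwards [hc.eventually_lt_const (abs_pos.2 hy)] with ε hε _ using hε
  obtain ⟨ε, h1, h2⟩ := (h.and self_mem_nhdsWithin).exists
  exact ⟨ε, h2, h1⟩

lemma pos_add_iff {a b : ℝ} (h : a ≠ 0 → |b| < |a|) (ha : a ≠ 0) : 0 < a + b ↔ 0 < a := by
  have h' := h ha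
  rcases lt_or_gt_of_ne ha with h1 | h1
  · rw [abs_of_neg h1] at h'
    have := abs_lt.1 h'
    constructor <;> intro h <;> linarith
  · rw [abs_of_pos h1] at h'
    have := abs_lt.1 h'
    constructor <;> intro h <;> linarith

lemma add_ne_zero_of_abs_lt {a b : ℝ} (h : |b| < |a|) : a + b ≠ 0 := by
  intro h0
  have : b = -a := by linarith
  rw [this, abs_neg] at h
  exact lt_irrefl _ h

/-- Perturbing a function that is generic up to one coordinate. -/
lemma isGeneric_add {p g : X → ℝ} {ε : ℝ} (hg : g ∈ Q)
    (hε : ∀ y ∈ A, p y ≠ 0 → |ε * g y| < |p y|) (hp : IsGeneric Q A p) :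
    IsGeneric Q A (p + ε • g) ∧ ∀ y ∈ A, (0 < (p + ε • g) y ↔ 0 < p y) := by
  constructor
  · intro y hy h0
    by_contra hne
    have hpy : p y ≠ 0 := fun h => hne (hp y hy h)
    exact add_ne_zero_of_abs_lt (hε y hy hpy) (by simpa using h0)
  · intro y hy
    by_cases hpy : p y = 0
    · simp [hpy, hp y hy hpy g hg]
    · simpa using pos_add_iff (hε y hy) hpy

/-- The members of `Q` that vanish at `x`. -/
def vanishingAt (Q : Submodule ℝ (X → ℝ)) (x : X) : Submodule ℝ (X → ℝ) :=
  Q ⊓ LinearMap.ker (LinearMap.proj (R := ℝ) (φ := fun _ : X => ℝ) x)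

lemma mem_vanishingAt {p : X → ℝ} : p ∈ vanishingAt Q x ↔ p ∈ Q ∧ p x = 0 := by
  simp [vanishingAt]

variable [DecidableEq X]

/-- If `p` vanishes at `x` needlessly, a small multiple of some `g` with `g x ≠ 0` moves it off zero
without changing a sign on `A`. -/
lemma exists_insert_generic (hx : x ∉ A) {p : X → ℝ} (hpQ : p ∈ Q) (hp : IsGeneric Q A p) :
    ∃ p' ∈ Q, IsGeneric Q (insert x A) p' ∧ ∀ y ∈ A, (0 < p' y ↔ 0 < p y) := by
  by_cases h : ∀ q ∈ Q, q x = 0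
  · refine ⟨p, hpQ, ?_, fun _ _ => Iff.rfl⟩
    intro y hy h0
    rcases Finset.mem_insert.1 hy with rfl | hy
    · exact h
    · exact hp y hy h0
  push Not at h
  by_cases hpx : p x = 0
  · obtain ⟨g, hg, hgx⟩ := h
    obtain ⟨ε, hε0, hε⟩ := exists_small_perturbation A p g
    obtain ⟨h1, h2⟩ := isGeneric_add hg hε hp
    refine ⟨p + ε • g, Q.add_mem hpQ (Q.smul_mem _ hg), ?_, h2⟩
    intro y hy h0
    rcases Finset.mem_insert.1 hy with rfl | hy
    · simp [hpx, hε0.ne', hgx] at h0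
    · exact h1 y hy h0
  · refine ⟨p, hpQ, ?_, fun _ _ => Iff.rfl⟩
    intro y hy h0
    rcases Finset.mem_insert.1 hy with rfl | hy
    · exact absurd h0 hpx
    · exact hp y hy h0

lemma posSets_ncard_le_insert (hx : x ∉ A) :
    (posSets Q A).ncard ≤ (posSets Q (insert x A)).ncard := by
  have hsub : posSets Q A ⊆ (fun P : Finset X => P.erase x) '' posSets Q (insert x A) := by
    rintro P ⟨p, hpQ, hp, rfl⟩
    obtain ⟨p', hp'Q, hp', hs⟩ := exists_insert_generic hx hpQ hp
    refine ⟨_, ⟨p', hp'Q, hp', rfl⟩, ?_⟩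
    ext y
    simp only [Finset.mem_erase, Finset.mem_filter, Finset.mem_insert]
    constructor
    · rintro ⟨h1, h2 | h2, h3⟩
      · exact absurd h2 h1
      · exact ⟨h2, (hs y h2).1 h3⟩
    · rintro ⟨h1, h2⟩
      exact ⟨fun h => hx (h ▸ h1), Or.inr h1, (hs y h1).2 h2⟩
  exact (Set.ncard_le_ncard hsub ((posSets_finite _ _).image _)).trans
    (Set.ncard_image_le (posSets_finite _ _))

/-- Deletion–restriction: a flat avoiding `x` is already a flat over `A`; one through `x` comes from
the functions vanishing at `x`. -/
lemma zeroSets_ncard_insert_le :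
    (zeroSets Q (insert x A)).ncard ≤
      (zeroSets Q A).ncard + (zeroSets (vanishingAt Q x) A).ncard := by
  have hsub : zeroSets Q (insert x A) ⊆
      zeroSets Q A ∪ (insert x) '' zeroSets (vanishingAt Q x) A := by
    rintro Z ⟨p, hp, rfl⟩
    by_cases h : p x = 0
    · refine Or.inr ⟨_, ⟨p, mem_vanishingAt.2 ⟨hp, h⟩, rfl⟩, ?_⟩
      rw [Finset.filter_insert, if_pos h]
    · refine Or.inl ⟨p, hp, ?_⟩
      rw [Finset.filter_insert, if_neg h]
  refine (Set.ncard_le_ncard hsub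
    ((zeroSets_finite _ _).union ((zeroSets_finite _ _).image _))).trans
    ((Set.ncard_union_le _ _).trans ?_)
  exact Nat.add_le_add_left (Set.ncard_image_le (zeroSets_finite _ _)) _

/-- The matching inequality for regions. A region of the restriction to `p x = 0` is cut in two by
the new hyperplane: moving by `± ε • g` with `g x > 0` reaches both sides. Hypothesis `hnp` says
that no hyperplane of `A` coincides with that of `x`, so that generic in the restriction still means
generic in `Q`. -/
lemma posSets_add_ncard_le_insert (hx : x ∉ A) (hQ : ∃ q ∈ Q, q x ≠ 0)
    (hnp : ∀ y ∈ A, (∃ q ∈ Q, q y ≠ 0) → ∃ q ∈ Q, q x = 0 ∧ q y ≠ 0) :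
    (posSets Q A).ncard + (posSets (vanishingAt Q x) A).ncard ≤
      (posSets Q (insert x A)).ncard := by
  set U := posSets Q (insert x A) with hU
  have hUf : U.Finite := posSets_finite _ _
  -- Here `a` and `b` are the traces on `A` of the regions on the two sides of `x`: their union
  -- contains all regions over `A`, their intersection those of the restriction.
  set a := (fun P : Finset X => P.erase x) '' {P ∈ U | x ∈ P}
  set b := {P ∈ U | x ∉ P}
  have haf : a.Finite := (hUf.subset (Set.sep_subset _ _)).image _
  have hbf : b.Finite := hUf.subset (Set.sep_subset _ _)
  have mem_ab : ∀ p ∈ Q, IsGeneric Q (insert x A) p → ∀ P : Finset X, P ⊆ A →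
      (∀ y ∈ A, (0 < p y ↔ y ∈ P)) → (0 < p x → P ∈ a) ∧ (¬ 0 < p x → P ∈ b) := by
    intro p hpQ hp P hPA hP
    have hxP : x ∉ P := fun h => hx (hPA h)
    have hfil : {y ∈ A | 0 < p y} = P := by
      ext y
      simp only [Finset.mem_filter]
      exact ⟨fun h => (hP y h.1).1 h.2, fun h => ⟨hPA h, (hP y (hPA h)).2 h⟩⟩
    constructor
    · intro h
      refine ⟨insert x P, ⟨⟨p, hpQ, hp, ?_⟩, Finset.mem_insert_self _ _⟩, ?_⟩
      · rw [Finset.filter_insert, if_pos h, hfil]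
      · exact Finset.erase_insert hxP
    · intro h
      refine ⟨⟨p, hpQ, hp, ?_⟩, hxP⟩
      rw [Finset.filter_insert, if_neg h, hfil]
  have h1 : posSets Q A ⊆ a ∪ b := by
    rintro P ⟨p, hpQ, hp, rfl⟩
    obtain ⟨p', hp'Q, hp', hs⟩ := exists_insert_generic hx hpQ hp
    have := mem_ab p' hp'Q hp' _ (Finset.filter_subset _ _)
      (fun y hy => by simp [hs y hy, hy] : ∀ y ∈ A, (0 < p' y ↔ y ∈ {x ∈ A | 0 < p x}))
    by_cases h : 0 < p' x
    · exact Or.inl (this.1 h)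
    · exact Or.inr (this.2 h)
  have h2 : posSets (vanishingAt Q x) A ⊆ a ∩ b := by
    rintro P ⟨p, hpQ, hp, rfl⟩
    obtain ⟨hpQ, hpx⟩ := mem_vanishingAt.1 hpQ
    obtain ⟨g, hgQ, hgx⟩ : ∃ g ∈ Q, 0 < g x := by
      obtain ⟨q, hq, hqx⟩ := hQ
      rcases lt_or_gt_of_ne hqx with h | h
      · exact ⟨-q, Q.neg_mem hq, by simpa using h⟩
      · exact ⟨q, hq, h⟩
    have hp' : IsGeneric Q A p := by
      intro y hy h0
      by_contra hne
      push Not at hne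
      obtain ⟨q, hq, hqx, hqy⟩ := hnp y hy hne
      exact hqy (hp y hy h0 q (mem_vanishingAt.2 ⟨hq, hqx⟩))
    obtain ⟨ε, hε0, hε⟩ := exists_small_perturbation A p g
    have key : ∀ δ : ℝ, |δ| = ε → IsGeneric Q (insert x A) (p + δ • g) ∧
        ∀ y ∈ A, (0 < (p + δ • g) y ↔ 0 < p y) := by
      intro δ hδ
      have hδ' : ∀ y ∈ A, p y ≠ 0 → |δ * g y| < |p y| := by
        intro y hy h
        have := hε y hy h
        rwa [abs_mul, abs_of_pos hε0, ← hδ, ← abs_mul] at this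
      obtain ⟨h3, h4⟩ := isGeneric_add hgQ hδ' hp'
      refine ⟨?_, h4⟩
      intro y hy h0
      rcases Finset.mem_insert.1 hy with rfl | hy
      · have : δ ≠ 0 := by
          rintro rfl
          simp at hδ
          exact hε0.ne hδ
        simp [hpx, this, hgx.ne'] at h0
      · exact h3 y hy h0
    constructor
    · obtain ⟨h3, h4⟩ := key ε (abs_of_pos hε0)
      refine (mem_ab _ (Q.add_mem hpQ (Q.smul_mem _ hgQ)) h3 _ (Finset.filter_subset _ _)
        (fun y hy => by rw [h4 y hy]; simp [hy])).1 ?_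
      simp [hpx]
      positivity
    · obtain ⟨h3, h4⟩ := key (-ε) (by rw [abs_neg, abs_of_pos hε0])
      refine (mem_ab _ (Q.add_mem hpQ (Q.smul_mem _ hgQ)) h3 _ (Finset.filter_subset _ _)
        (fun y hy => by rw [h4 y hy]; simp [hy])).2 ?_
      simp [hpx]
      positivity
  have h3 : a.ncard + b.ncard = U.ncard := by
    have ha : a.ncard = {P ∈ U | x ∈ P}.ncard := by
      refine Set.InjOn.ncard_image ?_
      rintro P ⟨-, hP⟩ P' ⟨-, hP'⟩ h
      rw [← Finset.insert_erase hP, ← Finset.insert_erase hP']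
      exact congrArg _ h
    rw [ha, ← Set.ncard_union_eq ?_ (hUf.subset (Set.sep_subset _ _)) hbf]
    · congr 1
      ext P
      simp only [Set.mem_union, Set.mem_ofPred_eq, b]
      tauto
    · rw [Set.disjoint_left]
      rintro P ⟨-, h⟩ ⟨-, h'⟩
      exact h' h
  calc _ ≤ (a ∪ b).ncard + (a ∩ b).ncard :=
        Nat.add_le_add (Set.ncard_le_ncard h1 (haf.union hbf))
          (Set.ncard_le_ncard h2 (haf.inter_of_left _))
    _ = a.ncard + b.ncard := Set.ncard_union_add_ncard_inter _ _ haf hbf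
    _ = _ := h3

lemma zeroSets_ncard_le_of_determined
    (h : ∀ p ∈ Q, ∀ q ∈ Q, (∀ y ∈ A, p y = 0 ↔ q y = 0) → (p x = 0 ↔ q x = 0)) :
    (zeroSets Q (insert x A)).ncard ≤ (zeroSets Q A).ncard := by
  refine Set.ncard_le_ncard_of_injOn (fun Z => {y ∈ Z | y ∈ A}) ?_ ?_ (zeroSets_finite _ _)
  · rintro Z ⟨p, hp, rfl⟩
    refine ⟨p, hp, ?_⟩
    ext y
    simp only [Finset.mem_filter, Finset.mem_insert]
    tauto
  · rintro Z ⟨p, hp, rfl⟩ Z' ⟨q, hq, rfl⟩ hZ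
    have h1 : ∀ y ∈ A, p y = 0 ↔ q y = 0 := by
      intro y hy
      have := Finset.ext_iff.1 hZ y
      simp only [Finset.mem_filter, Finset.mem_insert] at this
      tauto
    have h2 := h p hp q hq h1
    ext y
    simp only [Finset.mem_filter, Finset.mem_insert]
    constructor <;> rintro ⟨rfl | h3, h4⟩
    · exact ⟨Or.inl rfl, h2.1 h4⟩
    · exact ⟨Or.inr h3, (h1 y h3).1 h4⟩
    · exact ⟨Or.inl rfl, h2.2 h4⟩
    · exact ⟨Or.inr h3, (h1 y h3).2 h4⟩

/-- A hyperplane arrangement has at least as many regions as flats. -/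
theorem zeroSets_ncard_le_posSets_ncard (Q : Submodule ℝ (X → ℝ)) (A : Finset X) :
    (zeroSets Q A).ncard ≤ (posSets Q A).ncard := by
  induction A using Finset.induction_on generalizing Q with
  | empty =>
    have h1 : zeroSets Q ∅ ⊆ {∅} := by rintro Z ⟨p, -, rfl⟩; simp
    have h2 : {∅} ⊆ posSets Q ∅ := by
      rintro Z rfl
      exact ⟨0, Q.zero_mem, by simp [IsGeneric], by simp⟩
    exact Set.ncard_le_ncard (h1.trans h2) (posSets_finite _ _)
  | insert x A hx ih =>
    by_cases hQ : ∃ q ∈ Q, q x ≠ 0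
    · by_cases hnp : ∀ y ∈ A, (∃ q ∈ Q, q y ≠ 0) → ∃ q ∈ Q, q x = 0 ∧ q y ≠ 0
      · calc _ ≤ _ := zeroSets_ncard_insert_le
          _ ≤ _ := Nat.add_le_add (ih Q) (ih _)
          _ ≤ _ := posSets_add_ncard_le_insert hx hQ hnp
      · push Not at hnp
        obtain ⟨y, hyA, ⟨q₁, hq₁, hq₁y⟩, hy⟩ := hnp
        have hq₁x : q₁ x ≠ 0 := fun h => hq₁y (hy q₁ hq₁ h)
        -- The hyperplanes of `x` and `y` coincide: one kernel lies in the other and both have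
        -- codimension one. Adding `x` creates no new flat.
        have hiff : ∀ q ∈ Q, q x = 0 ↔ q y = 0 := by
          refine fun q hq => ⟨hy q hq, fun h => ?_⟩
          have h1 := hy (q - (q x / q₁ x) • q₁) (Q.sub_mem hq (Q.smul_mem _ hq₁))
            (by simp [hq₁x])
          simp only [Pi.sub_apply, Pi.smul_apply, smul_eq_mul, h, zero_sub, neg_eq_zero,
            mul_eq_zero, hq₁y, or_false, div_eq_zero_iff, hq₁x] at h1
          exact h1
        refine (zeroSets_ncard_le_of_determined ?_).trans
          ((ih Q).trans (posSets_ncard_le_insert hx))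
        intro p hp q hq h
        rw [hiff p hp, hiff q hq, h y hyA]
    · push Not at hQ
      refine (zeroSets_ncard_le_of_determined ?_).trans
        ((ih Q).trans (posSets_ncard_le_insert hx))
      intro p hp q hq _
      simp [hQ p hp, hQ q hq]

end Arrangement

end PTF

/-! ### Standard monomials and the Hilbert function of a subset of the cube -/

namespace PTF

-- If the low levels were too small, some level `j ≤ d` would have fewer than `C(m, j)` sets. The
-- total being at least `2 ^ m`, some level `i > d` would have more than `C(m, i)`. By
-- Kruskal–Katona its iterated shadow, which stays in the down-set, would have at least `C(m, j)`
-- sets at level `j`.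
open Finset in
lemma sum_choose_le_card_of_isLowerSet {n m d : ℕ} (hm : m ≤ n) {𝒟 : Finset (Finset (Fin n))}
    (h𝒟 : IsLowerSet (𝒟 : Set (Finset (Fin n)))) (hc : 2 ^ m ≤ #𝒟) :
    ∑ i ∈ range (d + 1), m.choose i ≤ #{A ∈ 𝒟 | #A ≤ d} := by
  have hslice : ∀ N, #{A ∈ 𝒟 | #A ≤ N} = ∑ i ∈ range (N + 1), #{A ∈ 𝒟 | #A = i} := by
    intro N
    rw [card_eq_sum_card_fiberwise (f := fun A => #A) (t := range (N + 1))]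
    · refine sum_congr rfl fun i hi => ?_
      rw [filter_filter]
      congr 1
      refine filter_congr fun A _ => ?_
      have := mem_range.1 hi
      constructor
      · rintro ⟨-, h⟩; exact h
      · intro h; exact ⟨by omega, h⟩
    · intro A hA
      have := (mem_filter.1 (mem_coe.1 hA)).2
      simp only [coe_range, Set.mem_Iio]
      omega
  by_contra! hlt
  rw [hslice] at hlt
  obtain ⟨j, hj, hj'⟩ := exists_lt_of_sum_lt hlt
  have hjd := mem_range.1 hj
  have htot : ∑ i ∈ range (n + d + 1), m.choose i ≤ ∑ i ∈ range (n + d + 1), #{A ∈ 𝒟 | #A = i} := by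
    rw [← hslice]
    have h1 : {A ∈ 𝒟 | #A ≤ n + d} = 𝒟 := by
      refine filter_true_of_mem fun A _ => ?_
      have := card_le_univ A
      simp only [Fintype.card_fin] at this
      omega
    have h2 : ∑ i ∈ range (n + d + 1), m.choose i = 2 ^ m := by
      rw [← Nat.sum_range_choose]
      refine (sum_subset (by intro i; simp; omega) ?_).symm
      intro i _ hi
      simp only [mem_range, not_lt] at hi
      exact Nat.choose_eq_zero_of_lt (by omega)
    rw [h1, h2]
    exact hc
  obtain ⟨i, hdi, hi⟩ : ∃ i, d < i ∧ m.choose i < #{A ∈ 𝒟 | #A = i} := by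
    by_contra! hcon
    have h1 : ∀ f : ℕ → ℕ, ∑ i ∈ range (n + d + 1), f i =
        ∑ i ∈ range (d + 1), f i + ∑ i ∈ Ico (d + 1) (n + d + 1), f i := by
      intro f
      rw [range_eq_Ico, range_eq_Ico, sum_Ico_consecutive] <;> omega
    rw [h1, h1] at htot
    have h2 : ∑ i ∈ Ico (d + 1) (n + d + 1), #{A ∈ 𝒟 | #A = i} ≤
        ∑ i ∈ Ico (d + 1) (n + d + 1), m.choose i :=
      sum_le_sum fun i hi => hcon i (by have := (mem_Ico.1 hi).1; omega)
    omega
  rcases le_or_gt i m with him | him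
  · have hkk := kruskal_katona_lovasz_form (𝒜 := {A ∈ 𝒟 | #A = i}) (i := i - j) (r := i) (k := m)
      (by omega) him hm (by intro A hA; exact (mem_filter.1 (mem_coe.1 hA)).2) hi.le
    have hij : i - (i - j) = j := by omega
    rw [hij] at hkk
    refine absurd (hkk.trans (card_le_card ?_)) (not_le.2 hj')
    intro B hB
    obtain ⟨A, hA, hBA, hcard⟩ := mem_shadow_iterate_iff_exists_mem_card_add.1 hB
    obtain ⟨hA𝒟, hAi⟩ := mem_filter.1 hA
    exact mem_filter.2 ⟨h𝒟 hBA hA𝒟, by omega⟩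
  -- Above level `m` the Lovász form does not apply, but the `j`-subsets of a single `i`-set already
  -- suffice.
  · obtain ⟨A, hA⟩ : ({A ∈ 𝒟 | #A = i}).Nonempty := card_pos.1 (by omega)
    obtain ⟨hA𝒟, hAi⟩ := mem_filter.1 hA
    have h1 : #(A.powersetCard j) ≤ #{A ∈ 𝒟 | #A = j} := by
      refine card_le_card fun B hB => ?_
      obtain ⟨h1, h2⟩ := mem_powersetCard.1 hB
      exact mem_filter.2 ⟨h𝒟 h1 hA𝒟, h2⟩
    rw [card_powersetCard, hAi] at h1
    have := Nat.choose_le_choose j him.le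
    omega

/-- An additive injective weight on monomials that refines the degree. -/
def weight {n : ℕ} (B : Finset (Fin n)) : ℕ := ∑ i ∈ B, (2 ^ n + 2 ^ (i : ℕ))

section Weight

variable {n : ℕ}

lemma weight_eq (B : Finset (Fin n)) :
    weight B = B.card * 2 ^ n + ∑ i ∈ B.map Fin.valEmbedding, 2 ^ i := by
  simp [weight, Finset.sum_add_distrib]

lemma sum_map_two_pow_lt (B : Finset (Fin n)) :
    ∑ i ∈ B.map Fin.valEmbedding, 2 ^ i < 2 ^ n := by
  refine Nat.geomSum_lt le_rfl fun k hk => ?_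
  obtain ⟨i, -, rfl⟩ := Finset.mem_map.1 hk
  exact i.2

lemma weight_injective : Function.Injective (weight (n := n)) := by
  intro B C h
  rw [weight_eq, weight_eq] at h
  have h1 := congrArg (· % 2 ^ n) h
  simp only [Nat.mul_add_mod_self_right, Nat.mod_eq_of_lt (sum_map_two_pow_lt _)] at h1
  exact Finset.map_injective _ (Finset.geomSum_injective le_rfl h1)

lemma weight_lt_iff (B : Finset (Fin n)) (d : ℕ) : weight B < (d + 1) * 2 ^ n ↔ B.card ≤ d := by
  rw [weight_eq]
  have h := sum_map_two_pow_lt B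
  constructor
  · intro h1
    by_contra! h2
    have : (d + 1) * 2 ^ n ≤ B.card * 2 ^ n := Nat.mul_le_mul_right _ h2
    omega
  · intro h1
    have : B.card * 2 ^ n ≤ d * 2 ^ n := Nat.mul_le_mul_right _ h1
    rw [add_mul, one_mul]
    omega

end Weight

/-- The monomial `B` as a function on the subset `Z` of the cube. -/
def monOn {n : ℕ} (Z : Finset (Finset (Fin n))) (B : Finset (Fin n)) : Z → ℝ :=
  fun A => if B ⊆ A.1 then 1 else 0

/-- The span on `Z` of the monomials of weight less than `t`. -/
def spanBelow {n : ℕ} (Z : Finset (Finset (Fin n))) (t : ℕ) : Submodule ℝ (Z → ℝ) :=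
  Submodule.span ℝ (monOn Z '' {B | weight B < t})

/-- `B` is a standard monomial of `Z`: on `Z`, it is no combination of monomials of smaller
weight. -/
def IsStandard {n : ℕ} (Z : Finset (Finset (Fin n))) (B : Finset (Fin n)) : Prop :=
  monOn Z B ∉ spanBelow Z (weight B)

section Standard

variable {n : ℕ} (Z : Finset (Finset (Fin n)))

-- As weights are distinct, raising `t` by one adds at most one generator, and the dimension grows
-- exactly when that generator is standard.
open Classical in
lemma finrank_spanBelow (t : ℕ) : Module.finrank ℝ (spanBelow Z t) =
    (Finset.univ.filter fun B => IsStandard Z B ∧ weight B < t).card := by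
  induction t with
  | zero =>
    have h : spanBelow Z 0 = ⊥ := by simp [spanBelow]
    rw [h]
    simp
  | succ t ih =>
    by_cases h : ∃ B : Finset (Fin n), weight B = t
    · obtain ⟨B, rfl⟩ := h
      have h1 : spanBelow Z (weight B + 1) =
          spanBelow Z (weight B) ⊔ Submodule.span ℝ {monOn Z B} := by
        rw [spanBelow, spanBelow, ← Submodule.span_union, ← Set.image_singleton,
          ← Set.image_union]
        congr 2
        ext C
        simp only [Set.mem_ofPred_eq, Set.mem_union, Set.mem_singleton_iff]
        rw [← weight_injective.eq_iff]
        omega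
      by_cases hB : IsStandard Z B
      · have h2 : (Finset.univ.filter fun C => IsStandard Z C ∧ weight C < weight B + 1) =
            insert B (Finset.univ.filter fun C => IsStandard Z C ∧ weight C < weight B) := by
          ext C
          simp only [Finset.mem_filter, Finset.mem_univ, true_and, Finset.mem_insert]
          rw [← weight_injective.eq_iff, Nat.lt_succ_iff_lt_or_eq]
          constructor
          · rintro ⟨h, h' | h'⟩
            · exact Or.inr ⟨h, h'⟩
            · exact Or.inl h'
          · rintro (h | h)
            · exact ⟨weight_injective h ▸ hB, Or.inr h⟩
            · exact ⟨h.1, Or.inl h.2⟩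
        rw [h2, Finset.card_insert_of_notMem (by simp), ← ih, h1]
        have h0 : monOn Z B ≠ 0 := fun h => hB (h ▸ Submodule.zero_mem _)
        have h3 := Submodule.finrank_sup_add_finrank_inf_eq (spanBelow Z (weight B))
          (Submodule.span ℝ {monOn Z B})
        have h4 : spanBelow Z (weight B) ⊓ Submodule.span ℝ {monOn Z B} = ⊥ := by
          rw [← disjoint_iff]
          exact (Submodule.disjoint_span_singleton' h0).2 hB
        rw [h4, finrank_bot, finrank_span_singleton h0] at h3
        omega
      · have h2 : (Finset.univ.filter fun C => IsStandard Z C ∧ weight C < weight B + 1) =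
            (Finset.univ.filter fun C => IsStandard Z C ∧ weight C < weight B) := by
          refine Finset.filter_congr fun C _ => ?_
          rw [Nat.lt_succ_iff_lt_or_eq]
          constructor
          · rintro ⟨h, h' | h'⟩
            · exact ⟨h, h'⟩
            · exact absurd (weight_injective h' ▸ h) hB
          · rintro ⟨h, h'⟩
            exact ⟨h, Or.inl h'⟩
        rw [h2, ← ih, h1, sup_eq_left.2]
        rw [Submodule.span_singleton_le_iff_mem]
        exact not_not.1 hB
    · push Not at h
      have h1 : spanBelow Z (t + 1) = spanBelow Z t := by
        unfold spanBelow
        congr 2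
        ext C
        have := h C
        simp only [Set.mem_ofPred_eq]
        omega
      rw [h1, ih]
      congr 1
      refine Finset.filter_congr fun C _ => ?_
      have := h C
      have h' : weight C < t + 1 ↔ weight C < t := by omega
      rw [h']

lemma monOn_insert (b : Fin n) (B : Finset (Fin n)) :
    monOn Z (insert b B) = monOn Z {b} * monOn Z B := by
  ext A
  simp only [monOn, Finset.insert_subset_iff, Finset.singleton_subset_iff, Pi.mul_apply]
  split_ifs <;> simp_all

lemma weight_insert {b : Fin n} {B : Finset (Fin n)} (hb : b ∉ B) :
    weight (insert b B) = 2 ^ n + 2 ^ (b : ℕ) + weight B := Finset.sum_insert hb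

variable {Z}

/-- Multiplying a relation for `B` by the variable `b` gives one for `insert b B`, since weight is
additive. Hence the standard monomials form a down-set. -/
lemma IsStandard.of_insert {b : Fin n} {B : Finset (Fin n)} (hb : b ∉ B)
    (h : IsStandard Z (insert b B)) : IsStandard Z B := by
  intro hB
  apply h
  have key : ∀ v ∈ spanBelow Z (weight B),
      monOn Z {b} * v ∈ spanBelow Z (weight (insert b B)) := by
    intro v hv
    induction hv using Submodule.span_induction with
    | mem v hv =>
      obtain ⟨C, hC, rfl⟩ := hv
      rw [← monOn_insert]
      refine Submodule.subset_span ⟨_, ?_, rfl⟩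
      simp only [Set.mem_ofPred_eq] at hC ⊢
      rw [weight_insert hb]
      -- On the 0-1 cube the variable `b` is idempotent, so a monomial already containing it keeps
      -- its weight.
      by_cases hbC : b ∈ C
      · rw [Finset.insert_eq_of_mem hbC]
        have := Nat.two_pow_pos n
        have := Nat.two_pow_pos b
        omega
      · rw [weight_insert hbC]
        omega
    | zero => simp
    | add u v _ _ hu hv => rw [mul_add]; exact Submodule.add_mem _ hu hv
    | smul c v _ hv => rw [mul_smul_comm]; exact Submodule.smul_mem _ _ hv
  rw [monOn_insert]
  exact key _ hB

lemma IsStandard.mono {B C : Finset (Fin n)} (hBC : B ⊆ C) (h : IsStandard Z C) :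
    IsStandard Z B := by
  induction C using Finset.induction_on generalizing B with
  | empty => rwa [Finset.subset_empty.1 hBC]
  | insert c C hc ih =>
    by_cases hcB : c ∈ B
    · have h1 : B.erase c ⊆ C := by
        intro x hx
        have := hBC (Finset.mem_of_mem_erase hx)
        exact (Finset.mem_insert.1 this).resolve_left (Finset.ne_of_mem_erase hx)
      by_contra hB
      have key : ∀ D : Finset (Fin n), Disjoint D B → ¬ IsStandard Z (D ∪ B) := by
        intro D
        induction D using Finset.induction_on with
        | empty => intro _; simpa using hB
        | insert a D ha ih' =>
          intro hD h'
          rw [Finset.disjoint_insert_left] at hD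
          rw [Finset.insert_union] at h'
          exact ih' hD.2 (h'.of_insert (by simp [ha, hD.1]))
      have h2 := key (insert c C \ B) Finset.sdiff_disjoint
      rw [Finset.sdiff_union_of_subset hBC] at h2
      exact h2 h
    · have h1 : B ⊆ C := (Finset.subset_insert_iff_of_notMem hcB).1 hBC
      exact ih h1 (h.of_insert hc)

variable (Z)

/-- Triangularity: test a relation on the monomial `A`, where `A` is a largest set with non-zero
coefficient; no other set in the relation contains it. -/
lemma monOn_cols_linearIndependent :
    LinearIndependent ℝ (fun (A : Z) (B : Finset (Fin n)) => monOn Z B A) := by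
  rw [Fintype.linearIndependent_iff]
  intro c hc
  by_contra! hne
  obtain ⟨A, hA, hmax⟩ := Finset.exists_max_image (Finset.univ.filter fun A : Z => c A ≠ 0)
    (fun A => A.1.card) (by obtain ⟨A, hA⟩ := hne; exact ⟨A, by simpa using hA⟩)
  have h1 := congrFun hc A.1
  simp only [Finset.sum_apply, Pi.smul_apply, smul_eq_mul, Pi.zero_apply] at h1
  rw [Finset.sum_eq_single A] at h1
  · simp [monOn] at h1
    simp [h1] at hA
  · intro A' _ hne'
    by_cases hcA : c A' = 0
    · simp [hcA]
    · have h2 := hmax A' (by simpa using hcA)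
      have h3 : ¬ A.1 ⊆ A'.1 := fun h =>
        hne' (Subtype.ext (Finset.eq_of_subset_of_card_le h h2).symm)
      simp [monOn, h3]
  · simp

lemma finrank_spanBelow_top {t : ℕ} (ht : ∀ B : Finset (Fin n), weight B < t) :
    Module.finrank ℝ (spanBelow Z t) = Z.card := by
  have h1 := (monOn_cols_linearIndependent Z).rank_matrix
    (M := Matrix.of fun (A : Z) (B : Finset (Fin n)) => monOn Z B A)
  rw [← Matrix.rank_transpose, Matrix.rank_eq_finrank_span_row] at h1
  rw [Fintype.card_coe] at h1
  rw [← h1]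
  have h2 : spanBelow Z t = Submodule.span ℝ (Set.range (Matrix.of fun (A : Z)
      (B : Finset (Fin n)) => monOn Z B A).transpose.row) := by
    refine congrArg _ (Set.ext fun v => ?_)
    constructor
    · rintro ⟨B, -, rfl⟩
      exact ⟨B, rfl⟩
    · rintro ⟨B, rfl⟩
      exact ⟨B, ht B, rfl⟩
  rw [h2]

end Standard

/-- The evaluation at `A` of all monomials of degree at most `d`. -/
def monVec {n : ℕ} (d : ℕ) (A : Finset (Fin n)) : Finset (Fin n) → ℝ :=
  fun B => if B.card ≤ d ∧ B ⊆ A then 1 else 0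

/-- A subspace of dimension less than `∑ i ≤ d, C(m, i)` contains the degree-`d` evaluation
vectors of fewer than `2 ^ m` points of the cube. -/
theorem card_lt_two_pow_of_finrank_lt {n m d : ℕ} (V : Submodule ℝ (Finset (Fin n) → ℝ))
    (hV : Module.finrank ℝ V < ∑ i ∈ Finset.range (d + 1), m.choose i)
    (Z : Finset (Finset (Fin n))) (hZ : ∀ A ∈ Z, monVec d A ∈ V) : Z.card < 2 ^ m := by
  classical
  by_contra! hlt
  have hm : m ≤ n := by
    by_contra! h
    have h1 := Finset.card_le_univ Z
    rw [Fintype.card_finset, Fintype.card_fin] at h1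
    have := Nat.pow_lt_pow_right (a := 2) (by norm_num) h
    omega
  set 𝒟 : Finset (Finset (Fin n)) := Finset.univ.filter (IsStandard Z) with h𝒟
  have hlow : IsLowerSet (𝒟 : Set (Finset (Fin n))) := by
    intro C B hBC hC
    simp only [h𝒟, Finset.coe_filter, Finset.mem_univ, true_and, Set.mem_ofPred_eq] at hC ⊢
    exact hC.mono hBC
  have hcard : 𝒟.card = Z.card := by
    have hw : ∀ B : Finset (Fin n), weight B < (n + 1) * 2 ^ n := fun B => by
      rw [weight_lt_iff]
      simpa using Finset.card_le_univ B
    rw [← finrank_spanBelow_top Z hw, finrank_spanBelow, h𝒟]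
    congr 1
    refine Finset.filter_congr fun B _ => ?_
    simp [hw B]
  have h1 := sum_choose_le_card_of_isLowerSet (d := d) hm hlow (hcard ▸ hlt)
  have h2 : (𝒟.filter fun A => A.card ≤ d).card =
      Module.finrank ℝ (spanBelow Z ((d + 1) * 2 ^ n)) := by
    rw [finrank_spanBelow, h𝒟, Finset.filter_filter]
    simp_rw [weight_lt_iff]
  -- The rows of `M` span the low-degree functions on `Z`, its columns lie in `V`; equality of row
  -- and column rank gives the contradiction.
  let M : Matrix (Finset (Fin n)) Z ℝ := Matrix.of fun B A => monVec d A.1 B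
  have h3 : spanBelow Z ((d + 1) * 2 ^ n) ≤ Submodule.span ℝ (Set.range M.row) := by
    rw [spanBelow, Submodule.span_le]
    rintro _ ⟨B, hB, rfl⟩
    simp only [Set.mem_ofPred_eq, weight_lt_iff] at hB
    refine Submodule.subset_span ⟨B, ?_⟩
    ext A
    simp [M, Matrix.row, monVec, monOn, hB]
  have h4 : Submodule.span ℝ (Set.range M.col) ≤ V := by
    rw [Submodule.span_le]
    rintro _ ⟨A, rfl⟩
    exact hZ A.1 A.2
  have h5 := Submodule.finrank_mono h3
  have h6 := Submodule.finrank_mono h4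
  rw [← Matrix.rank_eq_finrank_span_row] at h5
  rw [← Matrix.rank_eq_finrank_span_cols] at h6
  omega

end PTF

/-! ### The Littlewood–Offord inequality -/

namespace PTF

/-- The factor `2 * m + 1` lets the induction close, through `(2m + 1)(2m + 3) ≤ 4(m + 1)²`. -/
lemma centralBinom_sq_mul_le (m : ℕ) : m.centralBinom ^ 2 * (2 * m + 1) ≤ 16 ^ m := by
  induction m with
  | zero => simp
  | succ m ih =>
    have h := Nat.succ_mul_centralBinom_succ m
    have h1 : (m + 1) ^ 2 * ((m + 1).centralBinom ^ 2 * (2 * (m + 1) + 1)) ≤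
        (m + 1) ^ 2 * 16 ^ (m + 1) := by
      calc (m + 1) ^ 2 * ((m + 1).centralBinom ^ 2 * (2 * (m + 1) + 1))
          = ((m + 1) * (m + 1).centralBinom) ^ 2 * (2 * m + 3) := by ring
        _ = (m.centralBinom ^ 2 * (2 * m + 1)) * (4 * (2 * m + 1) * (2 * m + 3)) := by
            rw [h]; ring
        _ ≤ 16 ^ m * (16 * (m + 1) ^ 2) := Nat.mul_le_mul ih (by nlinarith)
        _ = _ := by ring
    exact Nat.le_of_mul_le_mul_left h1 (by positivity)

lemma choose_half_sq_mul_le (t : ℕ) : (t.choose (t / 2)) ^ 2 * t ≤ 4 ^ t := by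
  obtain ⟨m, rfl | rfl⟩ := Nat.even_or_odd' t
  · have h := centralBinom_sq_mul_le m
    rw [Nat.centralBinom] at h
    rw [Nat.mul_div_cancel_left _ (by norm_num), pow_mul]
    norm_num
    nlinarith [Nat.zero_le (((2 * m).choose m) ^ 2)]
  · have h := centralBinom_sq_mul_le (m + 1)
    have h1 : (m + 1).centralBinom = 2 * (2 * m + 1).choose m := by
      rw [Nat.centralBinom, show 2 * (m + 1) = (2 * m + 1) + 1 by ring, Nat.choose_succ_succ',
        Nat.choose_symm_half]
      ring
    rw [h1] at h
    have h2 : (2 * m + 1) / 2 = m := by omega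
    rw [h2, pow_succ 4, pow_mul]
    rw [pow_succ 16] at h
    norm_num
    nlinarith [Nat.zero_le (((2 * m + 1).choose m) ^ 2)]

open Finset in
/-- **Littlewood–Offord**: the subset sums of `s` non-zero reals take any given value for at most
a proportion `1 / √s` of the subsets. -/
theorem card_subset_sum_sq_mul_le {ι : Type*} [Fintype ι] [DecidableEq ι] (c : ι → ℝ) {s : ℕ}
    (hs : s ≤ #{i | c i ≠ 0}) (b : ℝ) :
    #{I : Finset ι | ∑ i ∈ I, c i = b} ^ 2 * s ≤ 4 ^ Fintype.card ι := by
  set T : Finset ι := {i | c i ≠ 0} with hT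
  set F : Finset (Finset ι) := {I : Finset ι | ∑ i ∈ I, c i = b} with hF
  have hfib : ∀ J ∈ (Tᶜ).powerset, #{I ∈ F | I \ T = J} ≤ (#T).choose (#T / 2) := by
    intro J _
    -- Complementing membership where `c` is negative makes the sum strictly increasing in `f I`
    -- once `I \ T` is fixed. Equal sums therefore force an antichain, and Sperner's theorem
    -- applies.
    let f : Finset ι → Finset T := fun I => {i | (i.1 ∈ I ↔ 0 < c i.1)}
    have key : ∀ I ∈ F, I \ T = J → ∀ I' ∈ F, I' \ T = J → f I ⊆ f I' → I = I' := by
      intro I hI hIJ I' hI' hIJ' hsub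
      have hoff : ∀ i, i ∉ T → (i ∈ I ↔ i ∈ I') := by
        intro i hi
        have h1 := Finset.ext_iff.1 (hIJ.trans hIJ'.symm) i
        simp only [mem_sdiff, hi, not_false_eq_true, and_true] at h1
        exact h1
      have hle : ∀ i ∈ (univ : Finset ι), (if i ∈ I then c i else 0) ≤
          (if i ∈ I' then c i else 0) := by
        intro i _
        by_cases hi : i ∈ T
        · have h1 := @hsub ⟨i, hi⟩
          simp only [f, mem_filter, mem_univ, true_and] at h1
          split_ifs with h2 h3 h3
          · exact le_rfl
          · exact not_lt.1 fun h => h3 ((h1 ⟨fun _ => h, fun _ => h2⟩).2 h)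
          · by_contra! h
            exact h.not_gt ((h1 ⟨fun h' => absurd h' h2, fun h' => absurd h' h.not_gt⟩).1 h3)
          · exact le_rfl
        · simp only [hoff i hi, le_refl]
      have hsum : ∑ i, (if i ∈ I then c i else 0) = ∑ i, (if i ∈ I' then c i else 0) := by
        simp only [sum_ite_mem, univ_inter]
        rw [(mem_filter.1 hI).2, (mem_filter.1 hI').2]
      have heq := (sum_eq_sum_iff_of_le hle).1 hsum
      ext i
      by_cases hi : i ∈ T
      · have h1 := heq i (mem_univ _)
        have h2 : c i ≠ 0 := (mem_filter.1 hi).2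
        split_ifs at h1 with h3 h4 h4
        · simp [h3, h4]
        · exact absurd h1 h2
        · exact absurd h1.symm h2
        · simp [h3, h4]
      · exact hoff i hi
    have hinj : Set.InjOn f ({I ∈ F | I \ T = J} : Finset (Finset ι)) := by
      intro I hI I' hI' h
      simp only [coe_filter, Set.mem_ofPred_eq] at hI hI'
      exact key I hI.1 hI.2 I' hI'.1 hI'.2 h.subset
    rw [← card_image_of_injOn hinj]
    have hanti : IsAntichain (· ⊆ ·)
        (SetLike.coe (image f {I ∈ F | I \ T = J})) := by
      intro K hK K' hK' hne hsub
      simp only [coe_image, coe_filter, Set.mem_image, Set.mem_ofPred_eq] at hK hK'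
      obtain ⟨I, hI, rfl⟩ := hK
      obtain ⟨I', hI', rfl⟩ := hK'
      exact hne (congrArg f (key I hI.1 hI.2 I' hI'.1 hI'.2 hsub))
    have := hanti.sperner
    rwa [Fintype.card_coe] at this
  have hcard := card_le_mul_card_image_of_maps_to (s := F) (f := fun I => I \ T)
    (t := (Tᶜ).powerset) (fun I _ => by
      rw [mem_powerset]; intro i hi; simpa using (mem_sdiff.1 hi).2) _ hfib
  rw [card_powerset, card_compl] at hcard
  have hTk : #T ≤ Fintype.card ι := card_le_univ T
  calc #F ^ 2 * s ≤ ((#T).choose (#T / 2) * 2 ^ (Fintype.card ι - #T)) ^ 2 * #T := by gcongr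
    _ = ((#T).choose (#T / 2) ^ 2 * #T) * 4 ^ (Fintype.card ι - #T) := by
      rw [mul_pow, ← pow_mul, mul_comm _ 2, pow_mul]; norm_num; ring
    _ ≤ 4 ^ #T * 4 ^ (Fintype.card ι - #T) := Nat.mul_le_mul_right _ (choose_half_sq_mul_le _)
    _ = 4 ^ Fintype.card ι := by rw [← pow_add]; congr 1; omega

end PTF

/-! ### Counting the flats spanned by tuples of points of the cube -/

namespace PTF

lemma exists_isGeneric {X : Type*} (U : Submodule ℝ (X → ℝ)) (A : Finset X) :
    ∃ p ∈ U, IsGeneric U A p := by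
  classical
  induction A using Finset.induction_on with
  | empty => exact ⟨0, U.zero_mem, by simp [IsGeneric]⟩
  | insert x A hx ih =>
    obtain ⟨p, hp, hg⟩ := ih
    obtain ⟨p', hp', hg', -⟩ := exists_insert_generic hx hp hg
    exact ⟨p', hp', hg'⟩

open Classical in
/-- The set of points at which all members of `Q` vanishing on the tuple `S` vanish. -/
noncomputable def flat {X ι : Type*} [Fintype X] (Q : Submodule ℝ (X → ℝ)) (S : ι → X) : Finset X :=
  {y | ∀ p ∈ Q, (∀ i, p (S i) = 0) → p y = 0}

section Flat

variable {X ι : Type*} [Fintype X] {Q : Submodule ℝ (X → ℝ)} {S : ι → X}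

/-- A generic member of the space of functions in `Q` vanishing on `S` vanishes only where all of
them do. -/
lemma flat_mem_zeroSets : flat Q S ∈ zeroSets Q Finset.univ := by
  let U : Submodule ℝ (X → ℝ) := Q ⊓ ⨅ i, vanishingAt ⊤ (S i)
  have hU : ∀ p, p ∈ U ↔ p ∈ Q ∧ ∀ i, p (S i) = 0 := by
    intro p
    simp [U, Submodule.mem_iInf, mem_vanishingAt]
  obtain ⟨p, hp, hg⟩ := exists_isGeneric U Finset.univ
  refine ⟨p, ((hU p).1 hp).1, ?_⟩
  ext y
  simp only [flat, Finset.mem_filter, Finset.mem_univ, true_and]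
  constructor
  · intro h
    exact h p ((hU p).1 hp).1 ((hU p).1 hp).2
  · intro h q hq hqS
    exact hg y (Finset.mem_univ _) h q ((hU q).2 ⟨hq, hqS⟩)

lemma mem_flat_self (i : ι) : S i ∈ flat Q S := by
  simp only [flat, Finset.mem_filter, Finset.mem_univ, true_and]
  exact fun p _ h => h i

/-- By duality, evaluation at `y` kills the common kernel of the evaluations at the `S i`, so it
lies in their span. -/
lemma exists_coeff_of_mem_flat [Fintype ι] {y : X} (hy : y ∈ flat Q S) :
    ∃ c : ι → ℝ, ∀ p ∈ Q, p y = ∑ i, c i * p (S i) := by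
  simp only [flat, Finset.mem_filter, Finset.mem_univ, true_and] at hy
  let ev : X → Q →ₗ[ℝ] ℝ := fun x =>
    (LinearMap.proj (R := ℝ) (φ := fun _ : X => ℝ) x).comp Q.subtype
  have h : ev y ∈ Submodule.span ℝ (Set.range fun i => ev (S i)) := by
    refine mem_span_of_iInf_ker_le_ker ?_
    intro p hp
    simp only [Submodule.mem_iInf, LinearMap.mem_ker] at hp ⊢
    exact hy p.1 p.2 hp
  obtain ⟨c, hc⟩ := (Submodule.mem_span_range_iff_exists_fun ℝ).1 h
  refine ⟨c, fun p hp => ?_⟩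
  have := LinearMap.congr_fun hc ⟨p, hp⟩
  simpa [ev] using this.symm

end Flat

section Tuples

variable {n m d : ℕ}

-- The tuple is built one point at a time: the span of the earlier vectors captures fewer than `2 ^
-- m` of the `2 ^ (m + 1)` points, leaving at least `2 ^ m` choices.
open Classical in
lemma two_pow_mul_le_card_linearIndependent {k : ℕ}
    (hk : k ≤ ∑ i ∈ Finset.range (d + 1), m.choose i) :
    2 ^ (m * k) ≤ (Finset.univ.filter fun S : Fin k → Finset (Fin (m + 1)) =>
      LinearIndependent ℝ fun i => monVec d (S i)).card := by
  induction k with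
  | zero => simp
  | succ k ih =>
    have h := ih (by omega)
    rw [mul_add, pow_add, mul_one, mul_comm (2 ^ (m * k))]
    refine (Nat.mul_le_mul_left _ h).trans ?_
    refine Finset.mul_card_image_le_card_of_maps_to 
      (f := fun S : Fin (k + 1) → Finset (Fin (m + 1)) => (Fin.tail S : Fin k → _)) ?_ _ ?_
    · intro S hS
      simp only [Finset.mem_filter, Finset.mem_univ, true_and] at hS ⊢
      exact hS.comp _ (Fin.succ_injective _)
    · intro v hv
      simp only [Finset.mem_filter, Finset.mem_univ, true_and] at hv
      set V := Submodule.span ℝ (Set.range fun i => monVec d (v i))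
      have hV : Module.finrank ℝ V < ∑ i ∈ Finset.range (d + 1), m.choose i := by
        have := finrank_range_le_card (R := ℝ) fun i => monVec d (v i)
        rw [Fintype.card_fin] at this
        exact lt_of_le_of_lt this (by omega)
      have hlt := card_lt_two_pow_of_finrank_lt V hV
        (Finset.univ.filter fun A => monVec d A ∈ V) (by simp)
      have hcompl := Finset.card_filter_add_card_filter_not (s := Finset.univ)
        (fun A : Finset (Fin (m + 1)) => monVec d A ∈ V)
      rw [Finset.card_univ, Fintype.card_finset, Fintype.card_fin, pow_succ] at hcompl
      have hle : 2 ^ m ≤ (Finset.univ.filter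
          fun A : Finset (Fin (m + 1)) => ¬ monVec d A ∈ V).card := by omega
      refine hle.trans ?_
      refine Finset.card_le_card_of_injOn (fun A => Fin.cons A v) ?_ ?_
      · intro A hA
        simp only [Finset.coe_filter, Finset.mem_univ, true_and, Set.mem_ofPred_eq,
          Finset.mem_filter] at hA ⊢
        refine ⟨?_, Fin.tail_cons _ _⟩
        have : (fun i : Fin (k + 1) => monVec d ((Fin.cons A v : Fin (k + 1) → _) i)) =
            Fin.cons (monVec d A) (fun i => monVec d (v i)) := by
          ext1 i
          refine Fin.cases ?_ (fun i => ?_) i <;> simp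
        rw [this, linearIndependent_finCons]
        exact ⟨hv, hA⟩
      · intro A _ B _ hAB
        have := congrFun hAB 0
        simpa using this

open Classical in
/-- Few points have evaluation vectors spanned by at most `s` members of a given tuple. -/
lemma card_span_small_le {k s : ℕ} (hd : 1 ≤ d) (hk : 1 ≤ k) (S : Fin k → Finset (Fin n)) :
    (Finset.univ.filter fun A : Finset (Fin n) => ∃ c : Fin k → ℝ,
      monVec d A = ∑ i, c i • monVec d (S i) ∧
      (Finset.univ.filter fun i => c i ≠ 0).card ≤ s).card ≤ k ^ s * 2 ^ s := by
  let W : (Fin s → Fin k) → Finset (Finset (Fin n)) := fun u => Finset.univ.filter fun A =>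
    monVec d A ∈ Submodule.span ℝ (Set.range fun j => monVec d (S (u j)))
  have hW : ∀ u, (W u).card ≤ 2 ^ s := by
    intro u
    refine (card_lt_two_pow_of_finrank_lt (d := d) _ ?_ (W u)
      (fun A hA => (Finset.mem_filter.1 hA).2)).le
    refine (finrank_range_le_card (R := ℝ) _).trans_lt ?_
    rw [Fintype.card_fin]
    -- Degree one is enough: `s` vectors have rank below `s + 1 = C(s, 0) + C(s, 1)`.
    have h1 : ∑ i ∈ Finset.range 2, s.choose i ≤ ∑ i ∈ Finset.range (d + 1), s.choose i :=
      Finset.sum_le_sum_of_subset (Finset.range_mono (by omega))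
    have h2 : ∑ i ∈ Finset.range 2, s.choose i = 1 + s := by simp [Finset.sum_range_succ]
    omega
  have hsub : (Finset.univ.filter fun A : Finset (Fin n) => ∃ c : Fin k → ℝ,
      monVec d A = ∑ i, c i • monVec d (S i) ∧
      (Finset.univ.filter fun i => c i ≠ 0).card ≤ s) ⊆ Finset.univ.biUnion W := by
    intro A hA
    simp only [Finset.mem_filter, Finset.mem_univ, true_and] at hA
    obtain ⟨c, hc, hcs⟩ := hA
    set T := Finset.univ.filter fun i => c i ≠ 0 with hT
    -- An enumeration of the support of `c`, padded with index `0` when the support has fewer than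
    -- `s` elements.
    let u : Fin s → Fin k := fun j => T.toList.getD j ⟨0, hk⟩
    refine Finset.mem_biUnion.2 ⟨u, Finset.mem_univ _, ?_⟩
    simp only [W, Finset.mem_filter, Finset.mem_univ, true_and]
    rw [hc]
    refine Submodule.sum_mem _ fun i _ => ?_
    by_cases hi : c i = 0
    · simp [hi]
    refine Submodule.smul_mem _ _ (Submodule.subset_span ?_)
    have hiT : i ∈ T.toList := by simp [hT, hi]
    obtain ⟨j, hj, rfl⟩ := List.mem_iff_getElem.1 hiT
    have hjs : j < s := by
      rw [Finset.length_toList] at hj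
      omega
    refine ⟨⟨j, hjs⟩, ?_⟩
    simp only [u]
    rw [List.getD_eq_getElem _ _ hj]
  calc _ ≤ _ := Finset.card_le_card hsub
    _ ≤ ∑ u : Fin s → Fin k, (W u).card := Finset.card_biUnion_le
    _ ≤ ∑ _u : Fin s → Fin k, 2 ^ s := Finset.sum_le_sum fun u _ => hW u
    _ = _ := by simp

end Tuples

/-- The point of `{0, 1} ^ n₁ × {0, 1} ^ n₂` in row `i` of a `k × (n₁ + n₂)` matrix with given
first rows and last columns. -/
def rowPoint {n₁ n₂ k : ℕ} (S : Fin k → Finset (Fin n₁)) (τ : Fin n₂ → Finset (Fin k)) (i : Fin k) :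
    Finset (Fin n₁) × Finset (Fin n₂) :=
  (S i, Finset.univ.filter fun j => i ∈ τ j)

/-- No combination of the tuple `S` with at least `s` terms representing a point of the cube
extends to a point of the cube by the columns `τ`. -/
def AvoidsLarge {n₁ n₂ k : ℕ} (d s : ℕ) (S : Fin k → Finset (Fin n₁))
    (τ : Fin n₂ → Finset (Fin k)) : Prop :=
  ∀ (A : Finset (Fin n₁)) (c : Fin k → ℝ), monVec d A = ∑ i, c i • monVec d (S i) →
    s ≤ (Finset.univ.filter fun i => c i ≠ 0).card →
    ¬ ∀ j, ∑ i ∈ τ j, c i = 0 ∨ ∑ i ∈ τ j, c i = 1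

section Avoid

variable {n₁ n₂ k d s : ℕ}

-- The columns are independent, and Littlewood–Offord bounds the proportion of good ones by `1 / √s`
-- for each of the two target values.
open Classical in
lemma card_columns_le (c : Fin k → ℝ) (hs0 : 1 ≤ s)
    (hs : s ≤ (Finset.univ.filter fun i => c i ≠ 0).card) :
    ((Finset.univ.filter fun τ : Fin n₂ → Finset (Fin k) =>
      ∀ j, ∑ i ∈ τ j, c i = 0 ∨ ∑ i ∈ τ j, c i = 1).card : ℝ) ≤
      (2 / √s) ^ n₂ * 2 ^ (k * n₂) := by
  have hs0' : (0 : ℝ) < s := by exact_mod_cast hs0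
  have hb : ∀ b : ℝ, ((Finset.univ.filter fun I : Finset (Fin k) => ∑ i ∈ I, c i = b).card : ℝ) ≤
      2 ^ k / √s := by
    intro b
    have h := card_subset_sum_sq_mul_le c hs b
    rw [Fintype.card_fin] at h
    rw [le_div_iff₀ (Real.sqrt_pos.2 hs0')]
    refine le_of_sq_le_sq ?_ (by positivity)
    rw [mul_pow, Real.sq_sqrt hs0'.le, ← pow_mul, mul_comm k 2, pow_mul]
    norm_num
    exact_mod_cast h
  set W := Finset.univ.filter fun I : Finset (Fin k) => ∑ i ∈ I, c i = 0 ∨ ∑ i ∈ I, c i = 1 with hW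
  have hWc : (W.card : ℝ) ≤ 2 / √s * 2 ^ k := by
    have h1 : W.card ≤ (Finset.univ.filter fun I : Finset (Fin k) => ∑ i ∈ I, c i = 0).card +
        (Finset.univ.filter fun I : Finset (Fin k) => ∑ i ∈ I, c i = 1).card := by
      rw [hW, Finset.filter_or]
      exact Finset.card_union_le _ _
    have h2 : (W.card : ℝ) ≤ 2 ^ k / √s + 2 ^ k / √s := by
      refine le_trans (by exact_mod_cast h1) (add_le_add (hb 0) (hb 1))
    calc _ ≤ _ := h2
      _ = _ := by ring
  have hcard : (Finset.univ.filter fun τ : Fin n₂ → Finset (Fin k) =>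
      ∀ j, ∑ i ∈ τ j, c i = 0 ∨ ∑ i ∈ τ j, c i = 1) = Fintype.piFinset fun _ => W := by
    ext τ
    simp [hW, Fintype.mem_piFinset]
  rw [hcard, Fintype.card_piFinset]
  simp only [Finset.prod_const, Finset.card_univ, Fintype.card_fin, Nat.cast_pow]
  rw [pow_mul, ← mul_pow]
  exact pow_le_pow_left₀ (by positivity) hWc _

-- Independence of `S` leaves at most one coefficient vector per point `A`. A union bound over the
-- `2 ^ n₁` points shows that at most half of the columns are bad; the extra factor 2 in `hLO`
-- provides the half.
open Classical in
lemma two_pow_le_card_avoidsLarge (hs0 : 1 ≤ s) {S : Fin k → Finset (Fin n₁)}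
    (hS : LinearIndependent ℝ fun i => monVec d (S i))
    (hLO : (2 : ℝ) ^ (n₁ + 1) * (2 / √s) ^ n₂ ≤ 1) :
    2 ^ (k * n₂) ≤ 2 * (Finset.univ.filter fun τ : Fin n₂ → Finset (Fin k) =>
      AvoidsLarge d s S τ).card := by
  let P : Finset (Fin n₁) → (Fin k → ℝ) → Prop := fun A c =>
    monVec d A = ∑ i, c i • monVec d (S i) ∧ s ≤ (Finset.univ.filter fun i => c i ≠ 0).card
  let B : Finset (Fin n₁) → Finset (Fin n₂ → Finset (Fin k)) := fun A =>
    Finset.univ.filter fun τ => ∃ c, P A c ∧ ∀ j, ∑ i ∈ τ j, c i = 0 ∨ ∑ i ∈ τ j, c i = 1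
  have huniq : ∀ A c c', P A c → P A c' → c = c' := by
    intro A c c' h h'
    have h1 : ∑ i, (c i - c' i) • monVec d (S i) = 0 := by
      simp only [sub_smul, Finset.sum_sub_distrib, ← h.1, ← h'.1, sub_self]
    have h2 := Fintype.linearIndependent_iff.1 hS _ h1
    ext i
    linarith [h2 i]
  have hB : ∀ A, ((B A).card : ℝ) ≤ (2 / √s) ^ n₂ * 2 ^ (k * n₂) := by
    intro A
    by_cases h : ∃ c, P A c
    · obtain ⟨c, hc⟩ := h
      refine le_trans ?_ (card_columns_le c hs0 hc.2)
      have : B A ⊆ Finset.univ.filter fun τ : Fin n₂ → Finset (Fin k) =>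
          ∀ j, ∑ i ∈ τ j, c i = 0 ∨ ∑ i ∈ τ j, c i = 1 := by
        intro τ hτ
        simp only [B, Finset.mem_filter, Finset.mem_univ, true_and] at hτ ⊢
        obtain ⟨c', hc', hτ⟩ := hτ
        rwa [huniq A c c' hc hc']
      exact_mod_cast Finset.card_le_card this
    · have : B A = ∅ := by
        refine Finset.filter_eq_empty_iff.2 fun τ _ h' => h ?_
        obtain ⟨c, hc, -⟩ := h'
        exact ⟨c, hc⟩
      rw [this]
      simp only [Finset.card_empty, Nat.cast_zero]
      positivity
  have hbad : (Finset.univ.filter fun τ : Fin n₂ → Finset (Fin k) => ¬ AvoidsLarge d s S τ) ⊆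
      Finset.univ.biUnion B := by
    intro τ hτ
    replace hτ := (Finset.mem_filter.1 hτ).2
    unfold AvoidsLarge at hτ
    push Not at hτ
    obtain ⟨A, c, h1, h2, h3⟩ := hτ
    refine Finset.mem_biUnion.2 ⟨A, Finset.mem_univ _, ?_⟩
    simp only [B, Finset.mem_filter, Finset.mem_univ, true_and]
    exact ⟨c, ⟨h1, h2⟩, h3⟩
  have hbadc : 2 * (Finset.univ.filter fun τ : Fin n₂ → Finset (Fin k) =>
      ¬ AvoidsLarge d s S τ).card ≤ 2 ^ (k * n₂) := by
    have h1 : ((Finset.univ.filter fun τ : Fin n₂ → Finset (Fin k) =>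
        ¬ AvoidsLarge d s S τ).card : ℝ) ≤ ∑ A, ((B A).card : ℝ) := by
      exact_mod_cast (Finset.card_le_card hbad).trans Finset.card_biUnion_le
    have h2 : ∑ A, ((B A).card : ℝ) ≤ 2 ^ n₁ * ((2 / √s) ^ n₂ * 2 ^ (k * n₂)) := by
      refine (Finset.sum_le_sum fun A _ => hB A).trans ?_
      simp
    have h3 : (2 : ℝ) * (2 ^ n₁ * ((2 / √s) ^ n₂ * 2 ^ (k * n₂))) ≤ 2 ^ (k * n₂) := by
      calc (2 : ℝ) * (2 ^ n₁ * ((2 / √s) ^ n₂ * 2 ^ (k * n₂))) =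
          (2 ^ (n₁ + 1) * (2 / √s) ^ n₂) * 2 ^ (k * n₂) := by ring
        _ ≤ 1 * 2 ^ (k * n₂) := by gcongr
        _ = _ := one_mul _
    have h4 : (2 : ℝ) * ((Finset.univ.filter fun τ : Fin n₂ → Finset (Fin k) =>
        ¬ AvoidsLarge d s S τ).card : ℝ) ≤ 2 ^ (k * n₂) := by linarith
    exact_mod_cast h4
  have htot := Finset.card_filter_add_card_filter_not (s := Finset.univ)
    (fun τ : Fin n₂ → Finset (Fin k) => AvoidsLarge d s S τ)
  rw [Finset.card_univ, Fintype.card_fun, Fintype.card_finset, Fintype.card_fin, Fintype.card_fin,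
    ← pow_mul] at htot
  omega

/-- For a good tuple the spanned flat is small. -/
lemma card_flat_le {Q : Submodule ℝ (Finset (Fin n₁) × Finset (Fin n₂) → ℝ)}
    (hQ₁ : ∀ B : Finset (Fin n₁), B.card ≤ d → (fun x => if B ⊆ x.1 then 1 else 0) ∈ Q)
    (hQ₂ : ∀ j : Fin n₂, (fun x => if j ∈ x.2 then 1 else 0) ∈ Q)
    (hd : 1 ≤ d) (hk : 1 ≤ k) {S : Fin k → Finset (Fin n₁)} {τ : Fin n₂ → Finset (Fin k)}
    (hτ : AvoidsLarge d s S τ) :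
    (flat Q (rowPoint S τ)).card ≤ k ^ s * 2 ^ s * 2 ^ n₂ := by
  classical
  have hsub : flat Q (rowPoint S τ) ⊆
      (Finset.univ.filter fun A : Finset (Fin n₁) => ∃ c : Fin k → ℝ,
        monVec d A = ∑ i, c i • monVec d (S i) ∧
        (Finset.univ.filter fun i => c i ≠ 0).card ≤ s) ×ˢ Finset.univ := by
    intro y hy
    obtain ⟨c, hc⟩ := exists_coeff_of_mem_flat hy
    rw [Finset.mem_product]
    refine ⟨?_, Finset.mem_univ _⟩
    have h1 : monVec d y.1 = ∑ i, c i • monVec d (S i) := by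
      ext B
      by_cases hB : B.card ≤ d
      · have h2 := hc _ (hQ₁ B hB)
        simp only [rowPoint] at h2
        simp only [monVec, hB, true_and, Finset.sum_apply, Pi.smul_apply, smul_eq_mul]
        exact h2
      · simp [monVec, hB]
    simp only [Finset.mem_filter, Finset.mem_univ, true_and]
    refine ⟨c, h1, ?_⟩
    by_contra! hlt
    -- The column sums of `c` are the last coordinates of `y`, hence 0 or 1, which a good `τ`
    -- forbids for large support.
    refine hτ y.1 c h1 hlt.le fun j => ?_
    have h2 := hc _ (hQ₂ j)
    simp only [rowPoint, Finset.mem_filter, Finset.mem_univ, true_and, mul_ite, mul_one,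
      mul_zero, Finset.sum_ite_mem, Finset.univ_inter] at h2
    rw [← h2]
    split_ifs <;> simp
  refine (Finset.card_le_card hsub).trans ?_
  rw [Finset.card_product, Finset.card_univ, Fintype.card_finset, Fintype.card_fin]
  exact Nat.mul_le_mul_right _ (card_span_small_le hd hk S)

lemma rowPoint_injective : Function.Injective
    (fun p : (Fin k → Finset (Fin n₁)) × (Fin n₂ → Finset (Fin k)) => rowPoint p.1 p.2) := by
  rintro ⟨S, τ⟩ ⟨S', τ'⟩ h
  simp only [Prod.mk.injEq]
  constructor
  · ext1 i
    exact congrArg Prod.fst (congrFun h i)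
  · ext j i
    have := Finset.ext_iff.1 (congrArg Prod.snd (congrFun h i)) j
    simpa [rowPoint] using this

open Classical in
/-- Many flats are spanned by `k`-tuples. -/
theorem two_pow_le_ncard_zeroSets {m : ℕ}
    {Q : Submodule ℝ (Finset (Fin (m + 1)) × Finset (Fin n₂) → ℝ)}
    (hQ₁ : ∀ B : Finset (Fin (m + 1)), B.card ≤ d → (fun x => if B ⊆ x.1 then 1 else 0) ∈ Q)
    (hQ₂ : ∀ j : Fin n₂, (fun x => if j ∈ x.2 then 1 else 0) ∈ Q)
    (hd : 1 ≤ d) (hk : 1 ≤ k) (hkm : k ≤ ∑ i ∈ Finset.range (d + 1), m.choose i) (hs : 1 ≤ s)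
    (hLO : (2 : ℝ) ^ (m + 2) * (2 / √s) ^ n₂ ≤ 1) :
    2 ^ ((m + n₂) * k) ≤
      2 * ((k ^ s * 2 ^ s * 2 ^ n₂) ^ k * (zeroSets Q Finset.univ).ncard) := by
  set L := Finset.univ.filter fun S : Fin k → Finset (Fin (m + 1)) =>
      LinearIndependent ℝ fun i => monVec d (S i) with hL
  set G := Finset.univ.filter
    fun p : (Fin k → Finset (Fin (m + 1))) × (Fin n₂ → Finset (Fin k)) =>
      p.1 ∈ L ∧ AvoidsLarge d s p.1 p.2 with hG
  have hLc := two_pow_mul_le_card_linearIndependent (d := d) hkm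
  have hGL : 2 ^ (k * n₂) * L.card ≤ 2 * G.card := by
    have : ∑ S ∈ L, 2 ^ (k * n₂) ≤ ∑ S ∈ L, 2 * (Finset.univ.filter
        fun τ : Fin n₂ → Finset (Fin k) => AvoidsLarge d s S τ).card :=
      Finset.sum_le_sum fun S hS =>
        two_pow_le_card_avoidsLarge hs (Finset.mem_filter.1 hS).2 hLO
    rw [Finset.sum_const, smul_eq_mul, mul_comm, ← Finset.mul_sum, ← Finset.card_sigma] at this
    refine this.trans (Nat.mul_le_mul_left _ ?_)
    refine Finset.card_le_card_of_injOn (fun p => (p.1, p.2)) ?_ ?_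
    · intro p hp
      simp only [Finset.coe_sigma, Set.mem_sigma_iff, Finset.mem_coe, Finset.mem_filter,
        Finset.mem_univ, true_and] at hp
      simp only [hG, Finset.coe_filter, Finset.mem_univ, true_and, Set.mem_ofPred_eq]
      exact hp
    · rintro ⟨S, τ⟩ _ ⟨S', τ'⟩ _ h
      simp only [Prod.mk.injEq] at h
      obtain ⟨rfl, rfl⟩ := h
      rfl
  have hzf := zeroSets_finite Q Finset.univ
  have hGz : G.card ≤ (k ^ s * 2 ^ s * 2 ^ n₂) ^ k * (zeroSets Q Finset.univ).ncard := by
    rw [Set.ncard_eq_toFinset_card _ hzf]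
    refine Finset.card_le_mul_card_image_of_maps_to
      (f := fun p => flat Q (rowPoint p.1 p.2)) ?_ _ ?_
    · intro p _
      rw [Set.Finite.mem_toFinset]
      exact flat_mem_zeroSets
    · intro Z _
      rcases (G.filter fun p => flat Q (rowPoint p.1 p.2) = Z).eq_empty_or_nonempty with h | h
      · rw [h]
        simp
      obtain ⟨p₀, hp₀⟩ := h
      obtain ⟨hp₀G, rfl⟩ := Finset.mem_filter.1 hp₀
      have hcard := card_flat_le hQ₁ hQ₂ hd hk (Finset.mem_filter.1 hp₀G).2.2
      set Z := flat Q (rowPoint p₀.1 p₀.2)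
      -- Distinct pairs give distinct tuples, all of whose entries lie in the flat `Z` that they
      -- span.
      calc _ ≤ (Fintype.piFinset fun _ : Fin k => Z).card := by
            refine Finset.card_le_card_of_injOn (fun p => rowPoint p.1 p.2) ?_
              rowPoint_injective.injOn
            intro p hp
            simp only [Finset.coe_filter, Set.mem_ofPred_eq] at hp
            rw [Finset.mem_coe, Fintype.mem_piFinset]
            intro i
            rw [← hp.2]
            exact mem_flat_self i
        _ = Z.card ^ k := by simp
        _ ≤ _ := Nat.pow_le_pow_left hcard _
  calc 2 ^ ((m + n₂) * k) = 2 ^ (k * n₂) * 2 ^ (m * k) := by rw [← pow_add]; congr 1; ring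
    _ ≤ 2 ^ (k * n₂) * L.card := Nat.mul_le_mul_left _ hLc
    _ ≤ 2 * G.card := hGL
    _ ≤ _ := Nat.mul_le_mul_left _ hGz

end Avoid

end PTF

/-! ### Polynomial threshold functions as sign patterns -/

namespace PTF

/-- The embedding of the sign cube into real space. -/
def toReal {n : ℕ} (z : Fin n → ℤˣ) : Fin n → ℝ := fun i => (((z i : ℤˣ) : ℤ) : ℝ)

/-- The functions on `X`, identified with the sign cube by `e`, given by polynomials of degree at
most `d`. -/
noncomputable def polySpace {n : ℕ} {X : Type*} (e : X ≃ (Fin n → ℤˣ)) (d : ℕ) : Submodule ℝ (X → ℝ) where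
  carrier := {p | ∃ P : MvPolynomial (Fin n) ℝ, P.totalDegree ≤ d ∧
    ∀ x, p x = MvPolynomial.eval (toReal (e x)) P}
  zero_mem' := ⟨0, by simp, by simp⟩
  add_mem' := by
    rintro p q ⟨P, hP, hp⟩ ⟨R, hR, hq⟩
    exact ⟨P + R, (MvPolynomial.totalDegree_add _ _).trans (max_le hP hR),
      fun x => by simp [hp x, hq x]⟩
  smul_mem' := by
    rintro c p ⟨P, hP, hp⟩
    exact ⟨c • P, (MvPolynomial.totalDegree_smul_le _ _).trans hP,
      fun x => by simp [hp x, MvPolynomial.smul_eval]⟩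

section

variable {n : ℕ} {X : Type*} (e : X ≃ (Fin n → ℤˣ)) {d : ℕ}

lemma one_mem_polySpace : (1 : X → ℝ) ∈ polySpace e d :=
  ⟨1, by simp, by simp⟩

lemma IsGeneric.ne_zero {A : Finset X} {p : X → ℝ} (hp : IsGeneric (polySpace e d) A p) {x : X}
    (hx : x ∈ A) : p x ≠ 0 := by
  intro h
  have := hp x hx h 1 (one_mem_polySpace e)
  simp at this

lemma intCast_unit_eq (u : ℤˣ) : (((u : ℤˣ) : ℤ) : ℝ) = if u = 1 then 1 else -1 := by
  rcases Int.units_eq_one_or u with rfl | rfl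
  · simp
  · simp [show ((-1 : ℤˣ) = 1) ↔ False by decide]

lemma sign_eq_iff {a : ℝ} (ha : a ≠ 0) (u : ℤˣ) :
    (((u : ℤˣ) : ℤ) : ℝ) = Real.sign a ↔ (u = 1 ↔ 0 < a) := by
  rw [intCast_unit_eq]
  rcases lt_or_gt_of_ne ha with h | h
  · rw [Real.sign_of_neg h]
    have : ¬ 0 < a := h.not_gt
    simp only [this, iff_false]
    split_ifs with hu
    · simp [hu]
      norm_num
    · simp [hu]
  · rw [Real.sign_of_pos h]
    simp only [h, iff_true]
    split_ifs with hu
    · simp [hu]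
    · simp only [hu, iff_false]
      norm_num

-- Since constants belong to the space, generic means nowhere zero, and a function is recovered from
-- the set where it equals 1.
open Classical in
lemma numPTF_eq_ncard_posSets [Fintype X] :
    numPTF n d = (posSets (polySpace e d) Finset.univ).ncard := by
  rw [← Nat.card_coe_set_eq, numPTF]
  have hmem : ∀ f : (Fin n → ℤˣ) → ℤˣ, IsPolynomialThreshold n d f ↔
      (Finset.univ.filter fun x => f (e x) = 1) ∈ posSets (polySpace e d) Finset.univ := by
    intro f
    constructor
    · rintro ⟨P, hP, h⟩
      refine ⟨fun x => MvPolynomial.eval (toReal (e x)) P, ⟨P, hP, fun _ => rfl⟩,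
        fun x _ h0 => absurd h0 (h (e x)).1, ?_⟩
      refine Finset.filter_congr fun x _ => ?_
      exact (sign_eq_iff (h (e x)).1 _).1 (h (e x)).2
    · rintro ⟨p, ⟨P, hP, hp⟩, hgen, heq⟩
      refine ⟨P, hP, fun z => ?_⟩
      have h1 : MvPolynomial.eval (toReal z) P = p (e.symm z) := by
        rw [hp, e.apply_symm_apply]
      have h2 : MvPolynomial.eval (toReal z) P ≠ 0 := by
        rw [h1]
        exact hgen.ne_zero e (Finset.mem_univ _)
      refine ⟨h2, (sign_eq_iff h2 _).2 ?_⟩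
      have := Finset.ext_iff.1 heq (e.symm z)
      simp only [Finset.mem_filter, Finset.mem_univ, true_and, e.apply_symm_apply] at this
      rw [this]
      exact iff_of_eq (congrArg _ h1.symm)
  refine Nat.card_eq_of_bijective (fun f : {f // IsPolynomialThreshold n d f} =>
    (⟨Finset.univ.filter fun x => f.1 (e x) = 1, (hmem f.1).1 f.2⟩ :
      posSets (polySpace e d) Finset.univ)) ⟨?_, ?_⟩
  · rintro ⟨f, hf⟩ ⟨g, hg⟩ h
    simp only [Subtype.mk.injEq] at h ⊢
    ext1 z
    have := Finset.ext_iff.1 h (e.symm z)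
    simp only [Finset.mem_filter, Finset.mem_univ, true_and, e.apply_symm_apply] at this
    rcases Int.units_eq_one_or (f z) with h1 | h1 <;>
      rcases Int.units_eq_one_or (g z) with h2 | h2 <;> simp_all
  · rintro ⟨P, hP⟩
    have h1 : (Finset.univ.filter fun x => (if e.symm (e x) ∈ P then (1 : ℤˣ) else -1) = 1) = P := by
      ext x
      simp only [Finset.mem_filter, Finset.mem_univ, true_and, e.symm_apply_apply]
      split_ifs with h
      · simp [h]
      · simp only [h, iff_false]
        decide
    refine ⟨⟨fun z => if e.symm z ∈ P then 1 else -1, (hmem _).2 ?_⟩, ?_⟩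
    · rw [h1]
      exact hP
    · exact Subtype.ext h1

/-- The `0`-`1` monomials have polynomial representations. -/
lemma prod_indicator_mem_polySpace {B : Finset (Fin n)} (hB : B.card ≤ d) :
    (fun x => if ∀ i ∈ B, e x i = 1 then 1 else 0) ∈ polySpace e d := by
  refine ⟨∏ i ∈ B, (MvPolynomial.C (1 / 2) * (MvPolynomial.X i + 1)), ?_, fun x => ?_⟩
  · refine (MvPolynomial.totalDegree_finsetProd _ _).trans ?_
    refine le_trans (Finset.sum_le_card_nsmul _ _ 1 fun i _ => ?_) (by simpa using hB)
    refine (MvPolynomial.totalDegree_mul _ _).trans ?_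
    rw [MvPolynomial.totalDegree_C, zero_add]
    refine (MvPolynomial.totalDegree_add _ _).trans ?_
    simp
  · have h : (if ∀ i ∈ B, e x i = 1 then (1 : ℝ) else 0) = ∏ i ∈ B, if e x i = 1 then 1 else 0 := by
      rw [Finset.prod_ite_zero]
      simp
    rw [map_prod]
    refine h.trans ?_
    refine Finset.prod_congr rfl fun i _ => ?_
    simp only [map_mul, MvPolynomial.eval_C, map_add, MvPolynomial.eval_X, map_one, toReal,
      intCast_unit_eq]
    split_ifs <;> norm_num

open Finset in
lemma card_filter_card_le (n d : ℕ) :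
    #{B : Finset (Fin n) | #B ≤ d} = ∑ i ∈ range (d + 1), n.choose i := by
  rw [card_eq_sum_card_fiberwise (f := fun A => #A) (t := range (d + 1))]
  · refine sum_congr rfl fun i hi => ?_
    rw [filter_filter]
    have h := card_powersetCard i (univ : Finset (Fin n))
    rw [card_univ, Fintype.card_fin] at h
    rw [← h]
    congr 1
    ext B
    have := mem_range.1 hi
    simp only [mem_filter, mem_univ, true_and, mem_powersetCard, subset_univ]
    constructor
    · rintro ⟨-, h⟩; exact h
    · intro h; exact ⟨by omega, h⟩
  · intro A hA
    have := (mem_filter.1 (mem_coe.1 hA)).2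
    simp only [coe_range, Set.mem_Iio]
    omega

lemma finrank_polySpace_le [Finite X] :
    Module.finrank ℝ (polySpace e d) ≤ ∑ i ∈ Finset.range (d + 1), n.choose i := by
  let χ : {B : Finset (Fin n) // B.card ≤ d} → X → ℝ := fun B x => ∏ i ∈ B.1, toReal (e x) i
  have hle : polySpace e d ≤ Submodule.span ℝ (Set.range χ) := by
    rintro p ⟨P, hP, hp⟩
    have hpe : p = ∑ α ∈ P.support, P.coeff α • fun x => ∏ i, toReal (e x) i ^ α i := by
      ext x
      rw [hp x, MvPolynomial.eval_eq']
      simp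
    rw [hpe]
    refine Submodule.sum_mem _ fun α hα => Submodule.smul_mem _ _ ?_
    have hdeg : ∑ i, α i ≤ d := by
      have := (MvPolynomial.le_totalDegree hα).trans hP
      rwa [Finsupp.sum_fintype _ _ (fun _ => rfl)] at this
    -- On the sign cube squares are 1, so only the parity of each exponent matters.
    refine Submodule.subset_span ⟨⟨Finset.univ.filter fun i => Odd (α i), ?_⟩, ?_⟩
    · refine le_trans ?_ hdeg
      rw [Finset.card_filter]
      refine Finset.sum_le_sum fun i _ => ?_
      split_ifs with h
      · exact h.pos
      · exact Nat.zero_le _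
    · ext x
      simp only [χ]
      rw [Finset.prod_filter]
      refine Finset.prod_congr rfl fun i _ => ?_
      have hsq : toReal (e x) i ^ 2 = 1 := by
        simp only [toReal, intCast_unit_eq]
        split_ifs <;> norm_num
      split_ifs with h
      · obtain ⟨k, hk⟩ := h
        rw [hk, pow_succ, pow_mul, hsq, one_pow, one_mul]
      · obtain ⟨k, hk⟩ := Nat.not_odd_iff_even.1 h
        rw [hk, ← two_mul, pow_mul, hsq, one_pow]
  refine (Submodule.finrank_mono hle).trans ((finrank_range_le_card _).trans ?_)
  rw [Fintype.card_subtype, card_filter_card_le]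

open Finset in
/-- The upper bound from the Sauer–Shelah lemma. -/
theorem numPTF_le_sum_choose (n d : ℕ) :
    numPTF n d ≤ ∑ i ∈ Iic (∑ i ∈ range (d + 1), n.choose i), (2 ^ n).choose i := by
  classical
  set N := ∑ i ∈ range (d + 1), n.choose i with hN
  let e : (Fin n → ℤˣ) ≃ (Fin n → ℤˣ) := Equiv.refl _
  have hf := posSets_finite (polySpace e d) univ
  rw [numPTF_eq_ncard_posSets e, Set.ncard_eq_toFinset_card _ hf]
  set 𝒜 := hf.toFinset
  have hX : Fintype.card (Fin n → ℤˣ) = 2 ^ n := by simp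
  refine (card_le_card_shatterer 𝒜).trans (card_shatterer_le_sum_vcDim.trans ?_)
  rw [hX]
  refine sum_le_sum_of_subset (Iic_subset_Iic.2 ?_)
  refine Finset.sup_le fun S hS => ?_
  rw [mem_shatterer] at hS
  by_contra! hlt
  -- A shattered `S` with more than `N` points is too large for the restrictions to fill `S → ℝ`, so
  -- a non-zero functional `φ` annihilates them. Shattering yields `p` positive exactly where the
  -- coefficients of `φ` are. All terms of `φ (res p) = 0` are then nonnegative, hence zero,
  -- although `p` has no zero and some coefficient is non-zero.
  let res : ((Fin n → ℤˣ) → ℝ) →ₗ[ℝ] (S → ℝ) := LinearMap.funLeft ℝ ℝ Subtype.val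
  have hne : (polySpace e d).map res < ⊤ := by
    rw [lt_top_iff_ne_top]
    intro h
    have h1 := congrArg (fun V : Submodule ℝ (S → ℝ) => Module.finrank ℝ V) h
    simp only [finrank_top, Module.finrank_fintype_fun_eq_card, Fintype.card_coe] at h1
    have h2 := Submodule.finrank_map_le res (polySpace e d)
    have h3 := finrank_polySpace_le e (d := d)
    omega
  obtain ⟨φ, hφ, hker⟩ := Submodule.exists_le_ker_of_lt_top _ hne
  have hφs : ∀ v : S → ℝ, φ v = ∑ x, v x * φ (Pi.single x 1) := by
    intro v
    conv_lhs => rw [pi_eq_sum_univ' v, map_sum]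
    refine sum_congr rfl fun x _ => ?_
    rw [map_smul, smul_eq_mul]
  obtain ⟨x₀, hx₀⟩ : ∃ x, φ (Pi.single x 1) ≠ 0 := by
    by_contra! h
    exact hφ (LinearMap.ext fun v => by rw [hφs]; simp [h])
  obtain ⟨u, hu, hSu⟩ := hS (t := ({x : S | 0 < φ (Pi.single x 1)} : Finset S).map
    (Function.Embedding.subtype _)) (by intro y hy; simp at hy; exact hy.1)
  obtain ⟨p, hp, hgen, rfl⟩ := hf.mem_toFinset.1 hu
  have hpos : ∀ x : S, 0 < p x.1 ↔ 0 < φ (Pi.single x 1) := by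
    intro x
    have := Finset.ext_iff.1 hSu x.1
    simpa using this
  have h0 : φ (res p) = 0 := hker (Submodule.mem_map_of_mem hp)
  rw [hφs] at h0
  have hterm : ∀ x ∈ (univ : Finset S), 0 ≤ res p x * φ (Pi.single x 1) := by
    intro x _
    change 0 ≤ p x.1 * _
    by_cases h : 0 < φ (Pi.single x 1)
    · exact mul_nonneg ((hpos x).2 h).le h.le
    · exact mul_nonneg_of_nonpos_of_nonpos (not_lt.1 fun h' => h ((hpos x).1 h')) (not_lt.1 h)
  have := (sum_eq_zero_iff_of_nonneg hterm).1 h0 x₀ (mem_univ _)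
  rcases mul_eq_zero.1 this with h | h
  · exact hgen.ne_zero e (mem_univ _) h
  · exact hx₀ h

/-- The trivial upper bound. -/
lemma numPTF_le_two_pow (n d : ℕ) : numPTF n d ≤ 2 ^ 2 ^ n := by
  refine (Nat.card_le_card_of_injective (β := (Fin n → ℤˣ) → ℤˣ) _ Subtype.val_injective).trans ?_
  simp

lemma two_le_numPTF (n d : ℕ) : 2 ≤ numPTF n d := by
  classical
  have h : ∀ u : ℤˣ, IsPolynomialThreshold n d fun _ => u := by
    intro u
    refine ⟨MvPolynomial.C (((u : ℤˣ) : ℤ) : ℝ),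
      (MvPolynomial.totalDegree_C _).le.trans (Nat.zero_le _), fun x => ?_⟩
    rw [MvPolynomial.eval_C, intCast_unit_eq]
    split_ifs
    · simp
    · simp [Real.sign_of_neg]
  rw [numPTF]
  refine le_trans (b := Nat.card ℤˣ) (by simp) ?_
  refine Nat.card_le_card_of_injective
    (fun u => (⟨fun _ => u, h u⟩ : {f : (Fin n → ℤˣ) → ℤˣ // IsPolynomialThreshold n d f})) ?_
  intro u v huv
  exact congrFun (Subtype.mk.inj huv) 1

end

/-- Subsets of a finite set as sign vectors. -/
def signEquiv (α : Type*) [Fintype α] [DecidableEq α] : Finset α ≃ (α → ℤˣ) where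
  toFun A i := if i ∈ A then 1 else -1
  invFun z := Finset.univ.filter fun i => z i = 1
  left_inv A := by
    ext i
    simp only [Finset.mem_filter, Finset.mem_univ, true_and]
    split_ifs with h
    · simp [h]
    · simp only [h, iff_false]
      decide
  right_inv z := by
    ext1 i
    simp only [Finset.mem_filter, Finset.mem_univ, true_and]
    rcases Int.units_eq_one_or (z i) with h | h
    · simp [h]
    · rw [h]
      decide

lemma signEquiv_eq_one {α : Type*} [Fintype α] [DecidableEq α] (A : Finset α) (i : α) :
    signEquiv α A i = 1 ↔ i ∈ A := by
  simp only [signEquiv, Equiv.coe_fn_mk]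
  split_ifs with h
  · simp [h]
  · simp only [h, iff_false]
    decide

/-- Pairs of subsets as sign vectors. -/
def signProdEquiv (n₁ n₂ : ℕ) :
    Finset (Fin n₁) × Finset (Fin n₂) ≃ (Fin (n₁ + n₂) → ℤˣ) :=
  ((signEquiv _).prodCongr (signEquiv _)).trans (Fin.appendEquiv n₁ n₂)

/-- The lower bound for the number of polynomial threshold functions. -/
theorem two_pow_le_numPTF {m n₂ d k s : ℕ} (hd : 1 ≤ d) (hk : 1 ≤ k)
    (hkm : k ≤ ∑ i ∈ Finset.range (d + 1), m.choose i) (hs : 1 ≤ s)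
    (hLO : (2 : ℝ) ^ (m + 2) * (2 / √s) ^ n₂ ≤ 1) :
    2 ^ ((m + n₂) * k) ≤ 2 * ((k ^ s * 2 ^ s * 2 ^ n₂) ^ k * numPTF (m + 1 + n₂) d) := by
  classical
  let e := signProdEquiv (m + 1) n₂
  have h1 : ∀ x i, e x (Fin.castAdd n₂ i) = 1 ↔ i ∈ x.1 := by
    intro x i
    rw [← signEquiv_eq_one]
    simp [e, signProdEquiv]
  have h2 : ∀ x i, e x (Fin.natAdd (m + 1) i) = 1 ↔ i ∈ x.2 := by
    intro x i
    rw [← signEquiv_eq_one]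
    simp [e, signProdEquiv]
  refine (two_pow_le_ncard_zeroSets (Q := polySpace e d) (fun B hB => ?_) (fun j => ?_)
    hd hk hkm hs hLO).trans ?_
  · have h := prod_indicator_mem_polySpace e (d := d) (B := B.map (Fin.castAddEmb n₂))
      (by simpa using hB)
    convert h using 3 with x
    simp [h1, Finset.subset_iff]
  · have h := prod_indicator_mem_polySpace e (d := d) (B := {Fin.natAdd (m + 1) j})
      (by simpa using hd)
    convert h using 3 with x
    simp [h2]
  · refine Nat.mul_le_mul_left _ (Nat.mul_le_mul_left _ ?_)
    rw [numPTF_eq_ncard_posSets e]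
    exact zeroSets_ncard_le_posSets_ncard _ _

end PTF

/-! ### The upper bound -/

namespace PTF

open Nat (factorial)

lemma pow_div_factorial_succ (n d : ℕ) :
    (n : ℝ) ^ (d + 1) / (factorial (d + 1) : ℝ) =
      (n : ℝ) ^ d / (factorial d : ℝ) * (n / (d + 1)) := by
  rw [Nat.factorial_succ]
  push_cast
  have : (factorial d : ℝ) ≠ 0 := by positivity
  field_simp
  ring

lemma cast_choose_succ (n d : ℕ) (hd : d ≤ n) :
    (n.choose (d + 1) : ℝ) = n.choose d * ((n - d) / (d + 1)) := by
  have h := Nat.choose_succ_right_eq n d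
  have h1 : (n.choose (d + 1) : ℝ) * (d + 1) = n.choose d * (n - d) := by
    rw [← Nat.cast_sub hd]
    exact_mod_cast h
  field_simp
  linarith

/-- This is the increment needed for the inductive step of `sum_choose_le`. It starts at index 3,
since it fails at index 2; at index 3 the slack is `n (n - 5) / 6`, whence `5 ≤ n`. -/
lemma choose_le_aux {n : ℕ} (hn : 5 ≤ n) (j : ℕ) (hj : j + 5 ≤ n) :
    (n.choose (j + 3) : ℝ) ≤ (n : ℝ) ^ (j + 3) / (factorial (j + 3) : ℝ) *
      ((1 + 1 / n) * (1 - (j + 3) / n)) := by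
  have hn0 : (0 : ℝ) < n := by positivity
  have hn5 : (5 : ℝ) ≤ n := by exact_mod_cast hn
  induction j with
  | zero =>
    have h1 := cast_choose_succ n 0 (by omega)
    have h2 := cast_choose_succ n 1 (by omega)
    have h3 := cast_choose_succ n 2 (by omega)
    simp only [Nat.choose_zero_right] at h1
    simp only [zero_add] at h1 h2 h3 ⊢
    rw [show (2 + 1 : ℕ) = 3 from rfl] at h3
    rw [show (1 + 1 : ℕ) = 2 from rfl] at h2
    rw [h3, h2, h1]
    have hf : (factorial 3 : ℝ) = 6 := by norm_num [Nat.factorial]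
    rw [hf]
    push_cast
    have h : (n : ℝ) ^ 3 / 6 * ((1 + 1 / n) * (1 - (0 + 3) / n)) -
        1 * ((n - 0) / (0 + 1)) * ((n - 1) / (1 + 1)) * ((n - 2) / (2 + 1)) =
        n * (n - 5) / 6 := by
      field_simp
      ring
    have h' : (0 : ℝ) ≤ n * (n - 5) / 6 := by
      have : (0 : ℝ) ≤ n - 5 := by linarith
      positivity
    linarith
  | succ j ih =>
    have ih := ih (by omega)
    have hjn : (j : ℝ) + 6 ≤ n := by exact_mod_cast (by omega : j + 6 ≤ n)
    rw [show j + 1 + 3 = (j + 3) + 1 by ring, cast_choose_succ n (j + 3) (by omega),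
      pow_div_factorial_succ]
    have h1 : (0 : ℝ) ≤ (n - (j + 3 : ℕ)) / ((j + 3 : ℕ) + 1) := by
      push_cast
      apply div_nonneg <;> linarith
    refine (mul_le_mul_of_nonneg_right ih h1).trans ?_
    have ha : (0 : ℝ) ≤ (n : ℝ) ^ (j + 3) / (factorial (j + 3) : ℝ) := by positivity
    simp only [mul_assoc]
    refine mul_le_mul_of_nonneg_left ?_ ha
    push_cast
    have h2 : (n : ℝ) / (j + 3 + 1) * ((1 + 1 / n) * (1 - (j + 1 + 3) / n)) -
        (1 + 1 / n) * (1 - (j + 3) / n) * ((n - (j + 3)) / (j + 3 + 1)) =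
        (1 + 1 / n) / (n * (j + 4)) * ((j + 2) * n - (j + 3) ^ 2) := by
      field_simp
      ring
    have h3 : (0 : ℝ) ≤ (j + 2) * n - (j + 3) ^ 2 := by
      nlinarith [Nat.cast_nonneg (α := ℝ) j]
    have h4 : (0 : ℝ) ≤ (1 + 1 / n) / (n * (j + 4)) * ((j + 2) * n - (j + 3) ^ 2) := by
      positivity
    linarith

/-- The number of non-constant monomials of degree at most `d`. -/
lemma sum_choose_le {n : ℕ} (hn : 5 ≤ n) {d : ℕ} (hd : 1 ≤ d) (hdn : d + 2 ≤ n) :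
    ((∑ i ∈ Finset.range (d + 1), n.choose i : ℕ) : ℝ) ≤
      1 + (n : ℝ) ^ d / (factorial d : ℝ) * (1 + 1 / n) := by
  have hn0 : (0 : ℝ) < n := by positivity
  induction d, hd using Nat.le_induction with
  | base =>
    simp [Finset.sum_range_succ]
    field_simp
    linarith
  | succ d hd ih =>
    have ih := ih (by omega)
    rw [Finset.sum_range_succ]
    push_cast at ih ⊢
    -- Degree 2 is treated apart: there the bound is an equality.
    rcases hd.eq_or_lt with rfl | hd
    · have h2 := cast_choose_succ n 1 (by omega)
      simp [Finset.sum_range_succ] at h2 ⊢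
      rw [h2]
      field_simp
      ring_nf
      linarith
    · obtain ⟨j, rfl⟩ := Nat.exists_eq_add_of_le' hd
      have h1 := choose_le_aux hn j (by omega)
      rw [show j + 1 + 1 + 1 = j + 3 by ring] at *
      rw [show j + (1 + 1) + 1 = j + 3 by ring] at *
      have h2 := pow_div_factorial_succ n (j + (1 + 1))
      rw [show j + (1 + 1) + 1 = j + 3 by ring] at h2
      have h3 : (n : ℝ) ^ (j + (1 + 1)) / (factorial (j + (1 + 1)) : ℝ) =
          (n : ℝ) ^ (j + 3) / (factorial (j + 3) : ℝ) * ((j + 3) / n) := by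
        rw [h2]
        push_cast
        field_simp
        ring
      have h4 : (n : ℝ) ^ (j + 3) / (factorial (j + 3) : ℝ) * ((j + 3) / n) * (1 + 1 / n) +
          (n : ℝ) ^ (j + 3) / (factorial (j + 3) : ℝ) * ((1 + 1 / n) * (1 - (j + 3) / n)) =
          (n : ℝ) ^ (j + 3) / (factorial (j + 3) : ℝ) * (1 + 1 / n) := by ring
      rw [h3] at ih
      linarith

open Finset in
/-- An exponential bound for partial sums of binomial coefficients. -/
lemma sum_choose_le_exp {M N : ℕ} (hN : 0 < N) (hNM : N ≤ M) :
    ((∑ i ∈ Iic N, M.choose i : ℕ) : ℝ) ≤ (Real.exp 1 * M / N) ^ N := by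
  have hM : 0 < M := by omega
  have hN' : (0 : ℝ) < N := by exact_mod_cast hN
  have hM' : (0 : ℝ) < M := by exact_mod_cast hM
  -- Compare with the expansion of `(1 + x) ^ M ≤ e ^ (x M)`; with this `x` the right side is `e ^
  -- N`.
  set x : ℝ := N / M with hx
  have hx0 : 0 < x := by positivity
  have hx1 : x ≤ 1 := by
    rw [hx, div_le_one hM']
    exact_mod_cast hNM
  have h1 : ((∑ i ∈ Iic N, M.choose i : ℕ) : ℝ) * x ^ N ≤ (x + 1) ^ M := by
    rw [add_pow]
    push_cast
    rw [sum_mul]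
    calc ∑ i ∈ Iic N, (M.choose i : ℝ) * x ^ N ≤ ∑ i ∈ Iic N, x ^ i * 1 ^ (M - i) * M.choose i := by
          refine sum_le_sum fun i hi => ?_
          rw [one_pow, mul_one, mul_comm]
          exact mul_le_mul_of_nonneg_right
            (pow_le_pow_of_le_one hx0.le hx1 (mem_Iic.1 hi)) (Nat.cast_nonneg _)
      _ ≤ _ := by
          refine sum_le_sum_of_subset_of_nonneg ?_ fun i _ _ => by positivity
          intro i hi
          have := mem_Iic.1 hi
          exact mem_range.2 (by omega)
  have h2 : (x + 1) ^ M ≤ Real.exp 1 ^ N := by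
    calc (x + 1) ^ M ≤ (Real.exp x) ^ M := pow_le_pow_left₀ (by positivity) (Real.add_one_le_exp x) _
      _ = Real.exp 1 ^ N := by
        rw [← Real.exp_nat_mul, ← Real.exp_nat_mul]
        congr 1
        rw [hx]
        field_simp
  have h3 : Real.exp 1 * M / N = Real.exp 1 / x := by
    rw [hx]
    field_simp
  rw [h3, div_pow, le_div_iff₀ (by positivity)]
  exact h1.trans h2

lemma numPTF_pos (n d : ℕ) : (0 : ℝ) < numPTF n d := by
  have := two_le_numPTF n d
  exact_mod_cast (by omega : 0 < numPTF n d)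

lemma logb_numPTF_le_two_pow (n d : ℕ) : Real.logb 2 (numPTF n d) ≤ 2 ^ n := by
  rw [Real.logb_le_iff_le_rpow (by norm_num) (numPTF_pos n d)]
  rw [show ((2 : ℝ) ^ n) = ((2 ^ n : ℕ) : ℝ) by push_cast; rfl, Real.rpow_natCast]
  exact_mod_cast numPTF_le_two_pow n d

lemma logb_numPTF_lt {n d E : ℕ} (h : numPTF n d < 2 ^ E) : Real.logb 2 (numPTF n d) < E := by
  rw [Real.logb_lt_iff_lt_rpow (by norm_num) (numPTF_pos n d), Real.rpow_natCast]
  exact_mod_cast h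

lemma two_pow_mul_factorial_le (n : ℕ) (hn : 1 ≤ n) : 2 ^ n * factorial n ≤ 2 * n ^ n := by
  induction n, hn using Nat.le_induction with
  | base => simp
  | succ n hn ih =>
    have h : 2 * n ^ n ≤ (n + 1) ^ n := by
      have h0 : (0 : ℝ) < n := by exact_mod_cast hn
      have h1 := one_add_mul_le_pow (a := 1 / (n : ℝ)) (by linarith [one_div_pos.2 h0]) n
      have h2 : (n : ℝ) * (1 + 1 / n) = n + 1 := by field_simp
      have h3 : 2 * (n : ℝ) ^ n ≤ (n + 1 : ℝ) ^ n := by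
        rw [mul_one_div_cancel h0.ne'] at h1
        rw [← h2, mul_pow]
        nlinarith [pow_pos h0 n]
      exact_mod_cast h3
    calc 2 ^ (n + 1) * factorial (n + 1) = 2 * (n + 1) * (2 ^ n * factorial n) := by
          rw [Nat.factorial_succ]; ring
      _ ≤ 2 * (n + 1) * (2 * n ^ n) := Nat.mul_le_mul_left _ ih
      _ ≤ 2 * (n + 1) * (n + 1) ^ n := Nat.mul_le_mul_left _ h
      _ = _ := by ring

/-- For both degrees the right side equals `n · n ^ n / n!`, which is at least `n · 2 ^ (n - 1)`;
this is where `n = d = 2` gives equality. -/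
lemma two_pow_le_of_le_add_one {n d : ℕ} (hn : 2 ≤ n) (hd : d = n ∨ d + 1 = n) :
    (2 : ℝ) ^ n ≤ (n : ℝ) ^ (d + 1) / (factorial d : ℝ) ∧
      (3 ≤ n → (2 : ℝ) ^ n < (n : ℝ) ^ (d + 1) / (factorial d : ℝ)) := by
  have h1 : (n : ℝ) ^ (d + 1) / (factorial d : ℝ) = (n : ℝ) ^ n / (factorial n : ℝ) * n := by
    rcases hd with rfl | rfl
    · rw [pow_succ]
      ring
    · rw [Nat.factorial_succ]
      push_cast
      field_simp
  have h2 : (2 : ℝ) ^ n * factorial n ≤ 2 * (n : ℝ) ^ n := by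
    exact_mod_cast two_pow_mul_factorial_le n (by omega)
  have hf : (0 : ℝ) < factorial n := by positivity
  have h3 : (2 : ℝ) ^ n ≤ 2 * ((n : ℝ) ^ n / (factorial n : ℝ)) := by
    rw [← mul_div_assoc, le_div_iff₀ hf]
    exact h2
  have h4 : (0 : ℝ) < (n : ℝ) ^ n / (factorial n : ℝ) := by positivity
  have h5 : (2 : ℝ) ≤ n := by exact_mod_cast hn
  rw [h1]
  constructor
  · nlinarith
  · intro h
    have h6 : (3 : ℝ) ≤ n := by exact_mod_cast h
    nlinarith

lemma logb_numPTF_lt_of_six_le {n d : ℕ} (hn : 6 ≤ n) (hd : 1 ≤ d) (hdn : d + 2 ≤ n) :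
    Real.logb 2 (numPTF n d) < (n : ℝ) ^ (d + 1) / (factorial d : ℝ) := by
  set N := ∑ i ∈ Finset.range (d + 1), n.choose i with hN
  have hn0 : (0 : ℝ) < n := by positivity
  have hn6 : (6 : ℝ) ≤ n := by exact_mod_cast hn
  have hNn : N ≤ 2 ^ n := by
    rw [← Nat.sum_range_choose, hN]
    exact Finset.sum_le_sum_of_subset (Finset.range_mono (by omega))
  have hN1 : n + 1 ≤ N := by
    have h1 : ∑ i ∈ Finset.range 2, n.choose i ≤ N :=
      Finset.sum_le_sum_of_subset (Finset.range_mono (by omega))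
    have h2 : ∑ i ∈ Finset.range 2, n.choose i = 1 + n := by simp [Finset.sum_range_succ]
    omega
  have hN0 : (0 : ℝ) < N := by exact_mod_cast (by omega : 0 < N)
  have hT : (numPTF n d : ℝ) ≤ (Real.exp 1 * (2 ^ n : ℕ) / N) ^ N :=
    le_trans (by exact_mod_cast numPTF_le_sum_choose n d) (sum_choose_le_exp (by omega) hNn)
  -- Each factor 2 by which `N` exceeds `e` saves one in the exponent.
  have hgain : ∀ t : ℕ, t ≤ n → Real.exp 1 * 2 ^ t ≤ N →
      Real.logb 2 (numPTF n d) ≤ ((n : ℝ) - t) * N := by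
    intro t htn ht
    rw [Real.logb_le_iff_le_rpow (by norm_num) (numPTF_pos n d)]
    refine hT.trans ?_
    rw [Real.rpow_mul (by norm_num), Real.rpow_natCast]
    refine pow_le_pow_left₀ (by positivity) ?_ _
    rw [← Nat.cast_sub htn, Real.rpow_natCast, div_le_iff₀ hN0]
    calc Real.exp 1 * (2 ^ n : ℕ) = 2 ^ (n - t) * (Real.exp 1 * 2 ^ t) := by
          push_cast
          rw [← Nat.sub_add_cancel htn, pow_add, Nat.add_sub_cancel]
          ring
      _ ≤ _ := by gcongr
  have he := Real.exp_one_lt_d9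
  rcases hd.eq_or_lt with rfl | hd2
  · have hNe : N = n + 1 := by simp [hN, Finset.sum_range_succ, add_comm]
    have h := hgain 1 (by omega) (by rw [hNe]; push_cast; linarith)
    refine h.trans_lt ?_
    rw [hNe]
    simp
    nlinarith
  -- The saving `t = 3` needs `N ≥ 8 e ≈ 21.75`, and 22 is the value of `N` at `n = 6`, `d = 2`.
  · have hN22 : 22 ≤ N := by
      have h1 : ∑ i ∈ Finset.range 3, n.choose i ≤ N :=
        Finset.sum_le_sum_of_subset (Finset.range_mono (by omega))
      have h2 : ∑ i ∈ Finset.range 3, (6 : ℕ).choose i ≤ ∑ i ∈ Finset.range 3, n.choose i :=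
        Finset.sum_le_sum fun i _ => Nat.choose_le_choose i hn
      have h3 : ∑ i ∈ Finset.range 3, (6 : ℕ).choose i = 22 := by decide
      omega
    have hN22' : (22 : ℝ) ≤ N := by exact_mod_cast hN22
    have h := hgain 3 (by omega) (by linarith)
    refine h.trans_lt ?_
    have hNa : (N : ℝ) ≤ _ := sum_choose_le (by omega) (by omega) hdn
    have hNn' : (n : ℝ) + 1 ≤ N := by exact_mod_cast hN1
    set a := (n : ℝ) ^ d / (factorial d : ℝ) with ha
    have hE : (n : ℝ) ^ (d + 1) / (factorial d : ℝ) = n * a := by rw [ha, pow_succ]; ring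
    rw [hE]
    have hinv : (1 : ℝ) + 1 / n ≤ 2 := by
      have : (1 : ℝ) / n ≤ 1 := by rw [div_le_one hn0]; linarith
      linarith
    have ha0 : 0 < a := by positivity
    have h2a : (n : ℝ) ≤ 2 * a := by nlinarith
    push_cast
    calc ((n : ℝ) - 3) * N ≤ (n - 3) * (1 + a * (1 + 1 / n)) :=
          mul_le_mul_of_nonneg_left hNa (by linarith)
      _ = n * a + (n - 3 - 2 * a) - 3 * a / n := by field_simp; ring
      _ < n * a := by
        have : 0 < 3 * a / n := by positivity
        linarith

/-- The upper bound. -/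
theorem logb_numPTF_upper {n d : ℕ} (hn : 1 < n) (hd : 1 ≤ d) (hdn : d ≤ n) :
    Real.logb 2 (numPTF n d) ≤ (n : ℝ) ^ (d + 1) / (factorial d : ℝ) ∧
      (¬(n = 2 ∧ d = 2) →
        Real.logb 2 (numPTF n d) < (n : ℝ) ^ (d + 1) / (factorial d : ℝ)) := by
  by_cases h22 : n = 2 ∧ d = 2
  · obtain ⟨rfl, rfl⟩ := h22
    exact ⟨(logb_numPTF_le_two_pow 2 2).trans (two_pow_le_of_le_add_one le_rfl (Or.inl rfl)).1,
      fun h => absurd ⟨rfl, rfl⟩ h⟩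
  suffices h : Real.logb 2 (numPTF n d) < (n : ℝ) ^ (d + 1) / (factorial d : ℝ) from
    ⟨h.le, fun _ => h⟩
  by_cases hd1 : n ≤ 5 ∧ d = 1
  · obtain ⟨h5, rfl⟩ := hd1
    have key : ∀ n : ℕ, ∑ i ∈ Finset.Iic (n + 1), (2 ^ n).choose i < 2 ^ n ^ 2 →
        Real.logb 2 (numPTF n 1) < (n : ℝ) ^ (1 + 1) / (factorial 1 : ℝ) := by
      intro n h
      have h1 := numPTF_le_sum_choose n 1
      have h2 : ∑ i ∈ Finset.range (1 + 1), n.choose i = n + 1 := by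
        simp [Finset.sum_range_succ, add_comm]
      rw [h2] at h1
      have h3 := logb_numPTF_lt (h1.trans_lt h)
      simpa using h3
    refine key n ?_
    rw [← Nat.range_succ_eq_Iic]
    interval_cases n <;> simp [Finset.sum_range_succ, Nat.choose]
  by_cases hnd : d = n ∨ d + 1 = n
  · refine (logb_numPTF_le_two_pow n d).trans_lt ((two_pow_le_of_le_add_one hn hnd).2 ?_)
    omega
  by_cases h6 : 6 ≤ n
  · exact logb_numPTF_lt_of_six_le h6 hd (by omega)
  · refine (logb_numPTF_le_two_pow n d).trans_lt ?_
    have : n = 4 ∧ d = 2 ∨ n = 5 ∧ d = 2 ∨ n = 5 ∧ d = 3 := by omega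
    rcases this with ⟨rfl, rfl⟩ | ⟨rfl, rfl⟩ | ⟨rfl, rfl⟩ <;> norm_num [Nat.factorial]

end PTF

/-! ### The lower bound -/

namespace PTF

open Nat (factorial)

lemma mul_le_logb_numPTF {m n₂ d k s : ℕ} (hd : 1 ≤ d) (hk : 1 ≤ k)
    (hkm : k ≤ ∑ i ∈ Finset.range (d + 1), m.choose i) (hs : 1 ≤ s)
    (hLO : (2 : ℝ) ^ (m + 2) * (2 / √s) ^ n₂ ≤ 1) :
    (k : ℝ) * (m - s * Real.logb 2 k - s - 1) ≤ Real.logb 2 (numPTF (m + 1 + n₂) d) := by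
  have h : (2 : ℝ) ^ ((m + n₂) * k) ≤
      2 * (((k : ℝ) ^ s * 2 ^ s * 2 ^ n₂) ^ k * numPTF (m + 1 + n₂) d) := by
    exact_mod_cast two_pow_le_numPTF hd hk hkm hs hLO
  have hk0 : (0 : ℝ) < k := by exact_mod_cast hk
  have hT := numPTF_pos (m + 1 + n₂) d
  have h1 := Real.logb_le_logb_of_le (b := 2) (by norm_num) (by positivity) h
  rw [Real.logb_mul (by norm_num) (by positivity), Real.logb_mul (by positivity) hT.ne',
    Real.logb_pow, Real.logb_pow, Real.logb_mul (by positivity) (by positivity),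
    Real.logb_mul (by positivity) (by positivity), Real.logb_pow, Real.logb_pow, Real.logb_pow,
    Real.logb_self_eq_one (by norm_num)] at h1
  push_cast at h1
  have hk1 : (1 : ℝ) ≤ k := by exact_mod_cast hk
  nlinarith

lemma eventually_log_bounds : ∃ n₀ : ℕ, ∀ n : ℕ, n₀ ≤ n →
    6 * Real.log n ^ 2 ≤ (n : ℝ) ^ (0.05 : ℝ) := by
  have h := (isLittleO_log_rpow_rpow_atTop (s := 0.05) 2 (by norm_num)).bound
    (show (0 : ℝ) < 1 / 6 by norm_num)
  have h' := (tendsto_natCast_atTop_atTop (R := ℝ)).eventually h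
  obtain ⟨n₀, hn₀⟩ := Filter.eventually_atTop.1 h'
  refine ⟨n₀, fun n hn => ?_⟩
  have h1 := hn₀ n hn
  rw [Real.rpow_two, Real.norm_of_nonneg (by positivity), Real.norm_of_nonneg (by positivity)] at h1
  linarith

/-- Since `√s ≥ e ^ (L / 40)` and `2 ≤ e ^ (L / 80)`, each column contributes at most `e ^ (-L /
80)`; `80 n / L` columns give `e ^ (-n)`, which beats `2 ^ (m + 2) ≤ e ^ n`. -/
lemma littlewoodOfford_condition {n : ℕ} {L u : ℝ} (hn : 1 ≤ n) (hL : L = Real.log n)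
    (hL1 : 100 ≤ L) (hu : u = (n : ℝ) ^ (0.05 : ℝ)) {s n₂ m : ℕ} (hs : u ≤ s)
    (hn₂ : 80 * n / L ≤ n₂) (hm : m + 2 ≤ n) :
    (2 : ℝ) ^ (m + 2) * (2 / √s) ^ n₂ ≤ 1 := by
  have hn0 : (0 : ℝ) < n := by exact_mod_cast hn
  have hL0 : 0 < L := by linarith
  have hu' : u = Real.exp (L * 0.05) := by rw [hu, Real.rpow_def_of_pos hn0, hL]
  have h2 : (2 : ℝ) ≤ Real.exp 1 := by
    have := Real.add_one_le_exp (1 : ℝ)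
    linarith
  have hsqrt : Real.exp (L * 0.025) ≤ √s := by
    apply Real.le_sqrt_of_sq_le
    rw [← Real.exp_nat_mul]
    refine le_trans (le_of_eq ?_) (hu'.symm.le.trans hs)
    congr 1
    push_cast
    ring
  have hq : 2 / √s ≤ Real.exp (-(L * 0.0125)) := by
    rw [div_le_iff₀ ((Real.exp_pos _).trans_le hsqrt)]
    calc (2 : ℝ) ≤ Real.exp 1 := h2
      _ ≤ Real.exp (-(L * 0.0125) + L * 0.025) := Real.exp_le_exp.2 (by linarith)
      _ = Real.exp (-(L * 0.0125)) * Real.exp (L * 0.025) := Real.exp_add _ _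
      _ ≤ _ := by gcongr
  calc (2 : ℝ) ^ (m + 2) * (2 / √s) ^ n₂
      ≤ Real.exp 1 ^ (m + 2) * Real.exp (-(L * 0.0125)) ^ n₂ := by gcongr
    _ = Real.exp ((m + 2 : ℕ) - n₂ * (L * 0.0125)) := by
      rw [← Real.exp_nat_mul, ← Real.exp_nat_mul, ← Real.exp_add]
      congr 1
      ring
    _ ≤ 1 := by
      rw [Real.exp_le_one_iff, sub_nonpos]
      have h3 : 80 * n ≤ n₂ * L := (div_le_iff₀ hL0).1 hn₂
      have h4 : ((m + 2 : ℕ) : ℝ) ≤ n := by exact_mod_cast hm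
      linarith

/-- The lower bound for large `n`. -/
lemma lower_of_large {n d : ℕ} (hd : 1 ≤ d) (hdn : (d : ℝ) ≤ (n : ℝ) ^ (0.9 : ℝ))
    (hL : 100 ≤ Real.log n) (hlarge : 6 * Real.log n ^ 2 ≤ (n : ℝ) ^ (0.05 : ℝ)) :
    (1 - 82 / Real.log n) ^ (d + 1) * ((n : ℝ) ^ (d + 1) / (factorial d : ℝ)) ≤
      Real.logb 2 (numPTF n d) := by
  have hn1 : 1 ≤ n := by
    by_contra! h
    have : n = 0 := by omega
    subst this
    simp at hL
    linarith
  have hn0 : (0 : ℝ) < n := by exact_mod_cast hn1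
  set L := Real.log n with hLdef
  set u := (n : ℝ) ^ (0.05 : ℝ) with hu
  set w := (n : ℝ) ^ (0.9 : ℝ) with hw
  have hL0 : 0 < L := by linarith
  have hu0 : 0 < u := by positivity
  have hw0 : 0 < w := by positivity
  have hwuu : w * u * u = n := by
    rw [hu, hw, ← Real.rpow_add hn0, ← Real.rpow_add hn0]
    norm_num
  have hw1 : 1 ≤ w := le_trans (by exact_mod_cast hd) hdn
  have hLu : 600 * L ≤ u := by nlinarith
  have hu1 : 1 ≤ u := by linarith
  have hnL : n / L * L = n := div_mul_cancel₀ _ hL0.ne'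
  have hwn : w ≤ n / L := by
    rw [le_div_iff₀ hL0, ← hwuu]
    calc w * L ≤ w * u := by gcongr; linarith
      _ ≤ w * u * u := le_mul_of_one_le_right (by positivity) hu1
  have h6 : 6 * (u * w * L) ≤ n / L := by
    rw [le_div_iff₀ hL0, ← hwuu]
    calc 6 * (u * w * L) * L = w * u * (6 * L ^ 2) := by ring
      _ ≤ w * u * u := by gcongr
  have huwL : u * w * L ≤ n / L := by
    have : 0 ≤ u * w * L := by positivity
    linarith
  have h3 : 100 ≤ u * w * L := by
    calc (100 : ℝ) = 1 * 1 * 100 := by norm_num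
      _ ≤ u * w * L := by gcongr
  set s := ⌈u⌉₊ with hs
  set n₂ := ⌈80 * n / L⌉₊ with hn₂
  have hsu : u ≤ s := Nat.le_ceil _
  have hsu2 : (s : ℝ) ≤ 2 * u := by
    have := Nat.ceil_lt_add_one hu0.le
    linarith
  have hs1 : 1 ≤ s := Nat.one_le_ceil_iff.2 hu0
  have hn₂l : 80 * n / L ≤ n₂ := Nat.le_ceil _
  have hn₂u : (n₂ : ℝ) ≤ 80 * n / L + 1 := (Nat.ceil_lt_add_one (by positivity)).le
  have hn₂1 : 1 ≤ n₂ := Nat.one_le_ceil_iff.2 (by positivity)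
  have h80 : 80 * (n : ℝ) / L = 80 * (n / L) := by ring
  have h100 : 100 * (n / L) ≤ n := by
    have : 0 ≤ n / L := by positivity
    have := mul_le_mul_of_nonneg_left hL this
    linarith
  have hn₂n : (n₂ : ℝ) + 1 + d ≤ n := by
    linarith
  have hn₂n' : n₂ + 1 + d ≤ n := by exact_mod_cast hn₂n
  obtain ⟨m, hm⟩ : ∃ m, n = m + 1 + n₂ := ⟨n - n₂ - 1, by omega⟩
  have hmR : (n : ℝ) = m + 1 + n₂ := by exact_mod_cast hm
  have hdm : d ≤ m := by omega
  set k := m.choose d with hk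
  have hk1 : 1 ≤ k := Nat.choose_pos hdm
  have hk0 : (0 : ℝ) < k := by exact_mod_cast hk1
  have hkm : k ≤ ∑ i ∈ Finset.range (d + 1), m.choose i :=
    Finset.single_le_sum (f := fun i => m.choose i) (fun i _ => Nat.zero_le _)
      (Finset.mem_range.2 (Nat.lt_succ_self d))
  have hLO := littlewoodOfford_condition hn1 hLdef hL hu hsu hn₂l (by omega : m + 2 ≤ n)
  have hmain := mul_le_logb_numPTF hd hk1 hkm hs1 hLO
  rw [← hm] at hmain
  refine le_trans ?_ hmain
  -- The factor 1.5 exceeds `1 / log 2`.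
  have hlogk : Real.logb 2 k ≤ 1.5 * (w * L) := by
    have hkn : (k : ℝ) ≤ (n : ℝ) ^ d := by
      have h1 : k ≤ m ^ d := Nat.choose_le_pow m d
      have h2 : m ^ d ≤ n ^ d := Nat.pow_le_pow_left (by omega) d
      exact_mod_cast h1.trans h2
    have h1 := Real.logb_le_logb_of_le (b := 2) (by norm_num) hk0 hkn
    rw [Real.logb_pow] at h1
    have h2 : Real.logb 2 n ≤ 1.5 * L := by
      have := Real.log_two_gt_d9
      rw [Real.logb, div_le_iff₀ (by linarith), ← hLdef]
      nlinarith
    calc Real.logb 2 k ≤ d * Real.logb 2 n := h1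
      _ ≤ w * (1.5 * L) := by
        refine mul_le_mul hdn h2 ?_ hw0.le
        exact Real.logb_nonneg (by norm_num) (by exact_mod_cast hn1)
      _ = _ := by ring
  have hlogk0 : 0 ≤ Real.logb 2 k := Real.logb_nonneg (by norm_num) (by exact_mod_cast hk1)
  have hslog : (s : ℝ) * Real.logb 2 k + s ≤ 5 * (u * w * L) := by
    calc (s : ℝ) * Real.logb 2 k + s ≤ 2 * u * (1.5 * (w * L)) + 2 * u := by gcongr
      _ ≤ 5 * (u * w * L) := by
        have : u ≤ u * (w * L) :=
          le_mul_of_one_le_right hu0.le (one_le_mul_of_one_le_of_one_le hw1 (by linarith))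
        linarith
  -- In units of `n / L`, the columns cost 80, and the terms in `s` together with the additive
  -- constants less than 1.
  have hsecond : n * (1 - 82 / L) ≤ m - s * Real.logb 2 k - s - 1 := by
    have : n * (1 - 82 / L) = n - 82 * (n / L) := by ring
    rw [this]
    linarith
  -- Here `C(m, d) ≥ (m + 1 - d) ^ d / d!`, and 82 is 80 for the columns, one for `d ≤ n / L` and
  -- one for rounding.
  have hfirst : (n * (1 - 82 / L)) ^ d / (factorial d : ℝ) ≤ k := by
    rw [div_le_iff₀ (by positivity)]
    have h1 := Nat.pow_sub_le_descFactorial m d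
    rw [Nat.descFactorial_eq_factorial_mul_choose, mul_comm] at h1
    have h2 : ((m + 1 - d : ℕ) : ℝ) ^ d ≤ (k : ℝ) * (factorial d : ℝ) := by exact_mod_cast h1
    refine le_trans (pow_le_pow_left₀ ?_ ?_ d) h2
    · have : 82 / L ≤ 1 := by rw [div_le_one hL0]; linarith
      exact mul_nonneg hn0.le (by linarith)
    · rw [Nat.cast_sub (by omega)]
      push_cast
      have : n * (1 - 82 / L) = n - 82 * (n / L) := by ring
      rw [this]
      linarith
  have hpos : 0 ≤ n * (1 - 82 / L) := by
    have : 82 / L ≤ 1 := by rw [div_le_one hL0]; linarith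
    exact mul_nonneg hn0.le (by linarith)
  calc (1 - 82 / L) ^ (d + 1) * ((n : ℝ) ^ (d + 1) / (factorial d : ℝ))
      = (n * (1 - 82 / L)) ^ d / (factorial d : ℝ) * (n * (1 - 82 / L)) := by
        rw [mul_pow]
        ring
    _ ≤ k * (m - s * Real.logb 2 k - s - 1) := mul_le_mul hfirst hsecond hpos hk0.le

theorem exists_lower_constant : ∃ C : ℝ, 0 < C ∧ ∀ n d : ℕ, 1 < n → 1 ≤ d →
    (d : ℝ) ≤ (n : ℝ) ^ (0.9 : ℝ) →
      (max 0 (1 - C / Real.log (n : ℝ))) ^ d * ((n : ℝ) ^ (d + 1) / (factorial d : ℝ))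
        < Real.logb 2 (numPTF n d : ℝ) := by
  obtain ⟨n₀, hn₀⟩ := eventually_log_bounds
  -- When `log n ≤ C` the left side is zero, so `C ≥ log n₀` disposes of small `n`. The value `164 =
  -- 2 · 82` allows the exponent `d + 1 ≤ 2 d` to be replaced by `d`, as `1 - 2 x < (1 - x) ^ 2`.
  refine ⟨max 164 (Real.log n₀), lt_max_of_lt_left (by norm_num), fun n d hn hd hdn => ?_⟩
  set C := max 164 (Real.log n₀) with hC
  have hC164 : 164 ≤ C := le_max_left _ _
  have hnR : (1 : ℝ) < n := by exact_mod_cast hn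
  have hL0 : 0 < Real.log n := Real.log_pos hnR
  rcases le_or_gt (1 - C / Real.log n) 0 with h | h
  · rw [max_eq_left h, zero_pow (by omega), zero_mul]
    refine Real.logb_pos (by norm_num) ?_
    have := two_le_numPTF n d
    exact_mod_cast (by omega : 1 < numPTF n d)
  · rw [max_eq_right h.le]
    have hCL : C < Real.log n := by
      have : C / Real.log n < 1 := by linarith
      rwa [div_lt_one hL0] at this
    have hnn₀ : n₀ ≤ n := by
      by_contra! hlt
      have h1 : Real.log n ≤ Real.log n₀ :=
        Real.log_le_log (by linarith) (by exact_mod_cast hlt.le)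
      have h2 : Real.log n₀ ≤ C := le_max_right _ _
      linarith
    refine lt_of_lt_of_le ?_ (lower_of_large hd hdn (by linarith) (hn₀ n hnn₀))
    have hE : 0 < (n : ℝ) ^ (d + 1) / (factorial d : ℝ) := by positivity
    refine mul_lt_mul_of_pos_right ?_ hE
    set x := 82 / Real.log n with hx
    have hx0 : 0 < x := by positivity
    have hxC : 2 * x ≤ C / Real.log n := by
      rw [hx, ← mul_div_assoc]
      gcongr
      linarith
    have hx1 : x < 1 := by linarith
    calc (1 - C / Real.log n) ^ d < ((1 - x) ^ 2) ^ d := by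
          refine pow_lt_pow_left₀ ?_ h.le (by omega)
          nlinarith
      _ = (1 - x) ^ (2 * d) := by rw [pow_mul]
      _ ≤ (1 - x) ^ (d + 1) :=
          pow_le_pow_of_le_one (by linarith) (by linarith) (by omega)

end PTF

/-! ### Combination of the two bounds. -/

theorem corollary1p2 :
    (∃ C : ℝ, 0 < C ∧ ∀ n d : ℕ, 1 < n → 1 ≤ d → (d : ℝ) ≤ (n : ℝ) ^ (0.9 : ℝ) →
      (max 0 (1 - C / Real.log (n : ℝ))) ^ d * ((n : ℝ) ^ (d + 1) / (Nat.factorial d : ℝ))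
          < Real.logb 2 (numPTF n d : ℝ) ∧
        Real.logb 2 (numPTF n d : ℝ) < (n : ℝ) ^ (d + 1) / (Nat.factorial d : ℝ)) ∧
    (∀ n d : ℕ, 1 < n → 1 ≤ d → d ≤ n →
      Real.logb 2 (numPTF n d : ℝ) ≤ (n : ℝ) ^ (d + 1) / (Nat.factorial d : ℝ) ∧
        (¬(n = 2 ∧ d = 2) →
          Real.logb 2 (numPTF n d : ℝ) < (n : ℝ) ^ (d + 1) / (Nat.factorial d : ℝ))) := by
  refine ⟨?_, fun n d hn hd hdn => PTF.logb_numPTF_upper hn hd hdn⟩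
  obtain ⟨C, hC, h⟩ := PTF.exists_lower_constant
  refine ⟨C, hC, fun n d hn hd hdn => ⟨h n d hn hd hdn, ?_⟩⟩
  have hnR : (1 : ℝ) < n := by exact_mod_cast hn
  have hlt : (d : ℝ) < n := by
    refine hdn.trans_lt ?_
    calc (n : ℝ) ^ (0.9 : ℝ) < (n : ℝ) ^ (1 : ℝ) :=
          Real.rpow_lt_rpow_of_exponent_lt hnR (by norm_num)
      _ = n := Real.rpow_one _
  have hlt' : d < n := by exact_mod_cast hlt
  exact (PTF.logb_numPTF_upper hn hd hlt'.le).2 (by omega)
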